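/- Let $k\ge 3$ and $s\ge k+3$ be integers. For $\mathbf a=(a_1,\dots,a_s)\in(\mathbb Z\setminus\{0\})^s$ write $|\mathbf a|=\max_j|a_j|$, and for each prime $p$ let $$\chi_p(\mathbf a)=\lim_{h\to\infty}p^{h(1-s)}\,\#\{\mathbf x\in\mathbb Z^s:\ 1\le x_j\le p^h\ (1\le j\le s),\ a_1x_1^k+\dots+a_sx_s^k\equiv 0 \pmod{p^h}\},\qquad \mathfrak S_{\mathbf a}=\prod_p\chi_p(\mathbf a),$$ the product being over all primes $p$. For every $\mathbf a\in(\mathbb Z\setminus\{0\})^s$ all these limits exist and the product converges absolutely, that is, $\sum_p|\chi_p(\mathbf a)-1|<\infty$. Moreover, for every real $\eta>0$ there are real numbers $\gamma>0$ and $C$, depending only on $k$, $s$ and $\eta$, such that for all real $A\ge 1$ $$\#\{\mathbf a\in(\mathbb Z\setminus\{0\})^s:\ |\mathbf a|\le A,\ 0<\mathfrak S_{\mathbf a}<A^{-\eta}\}\le C\,A^{s-\gamma}.$$ -/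

import Mathlib

/-- The number of integer vectors `x` with `1 ≤ x_j ≤ p ^ h` for all `j` and
`a_1 x_1 ^ k + ⋯ + a_s x_s ^ k ≡ 0 (mod p ^ h)`. -/
noncomputable def congruenceCount (k : ℕ) {s : ℕ} (a : Fin s → ℤ) (p h : ℕ) : ℕ :=
  ((Fintype.piFinset fun _ : Fin s => Finset.Icc (1 : ℤ) ((p : ℤ) ^ h)).filter
    fun x => (∑ j, a j * x j ^ k) ≡ 0 [ZMOD (p : ℤ) ^ h]).card

/-- The normalised count `p ^ (h (1 - s)) * congruenceCount k a p h`. -/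
noncomputable def normalizedCount (k : ℕ) {s : ℕ} (a : Fin s → ℤ) (p h : ℕ) : ℝ :=
  (p : ℝ) ^ ((h : ℤ) * (1 - (s : ℤ))) * (congruenceCount k a p h : ℝ)

/-- The `p`-adic density `χ_p(a)`, the limit of the normalised counts as `h → ∞`. -/
noncomputable def localDensity (k : ℕ) {s : ℕ} (a : Fin s → ℤ) (p : ℕ) : ℝ :=
  Filter.limUnder Filter.atTop fun h : ℕ => normalizedCount k a p h

/-- The singular product `𝔖_a = ∏_p χ_p(a)` over all primes `p`. -/
noncomputable def singularProduct (k : ℕ) {s : ℕ} (a : Fin s → ℤ) : ℝ :=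
  ∏' p : Nat.Primes, localDensity k a (p : ℕ)

/-!
# Small values of the singular product of diagonal forms

*Local densities.* Split the zeros of the form modulo `p ^ h` according to whether some coordinate
is a unit. If `p ^ (v + 1)` divides no `k a_j`, Hensel's lemma makes the normalised number of zeros
with a unit coordinate constant for `h ≥ 2 v + 1` (`unitDensity_stable`), say equal to `P`. The
other zeros are multiples of `p`, which gives the recursion `M_{h+k} = P + p ^ (k - s) M_h` for the
normalised counts. Hence the density exists and equals `P / (1 - p ^ (k - s))`
(`tendsto_normalizedCount`). If it is positive, then `P ≠ 0`, so there is at least one zero with a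
unit coordinate modulo `p ^ (2 v + 1)` and the density is at least `p ^ (-(2 v + 1) (s - 1))`
(`le_localDensity_of_pos`).

*Large primes.* Averaging over the classes `c t ^ k` shows that the sums `∑ x, e(c x ^ k / p)` with
`p ∤ c` are `O(√p)`. As `s ≥ 6`, it follows that the density is at least `1 - O(p ^ (-3/2))`
at each prime `p > k` dividing at most one coefficient, and is `1 + O(p ^ (-3/2))` if `p` divides
none. This gives absolute convergence, and it leaves only the primes dividing a fixed integer `Q`
and those dividing two coefficients as possible sources of a small product. Each of these is
controlled by the largest power of `p` in a coefficient, and the product of these powers is at most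
the product, over the pairs `i ≠ j`, of the part of `a_i` composed of primes dividing `Q a_j`
(`exists_le_singularProduct`).

*Counting.* If `0 < 𝔖_a < A ^ (-η)`, then for some pair that part is at least a fixed positive power
of `A`, up to a constant. By Rankin's trick, for each `n` only
`O(A D ^ (-1/2) 4 ^ ω(n))` of the integers up to `A` have a part of size `D` or more composed of
primes dividing `n` (`card_sharedPart_ge_le`), and `4 ^ ω(n)` is smaller than any power of `n`.
-/

/-! ### Counting zeros in residue rings -/

/-- Reduction `ℤ/p^n → ℤ/p^m` for `m ≤ n`. -/
def powReduction (p : ℕ) {m n : ℕ} (hmn : m ≤ n) : ZMod (p ^ n) →+* ZMod (p ^ m) :=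
  ZMod.castHom (pow_dvd_pow p hmn) (ZMod (p ^ m))

/-- The diagonal form `∑ a_j x_j ^ k` over a commutative ring. -/
def diagForm {R : Type*} [CommRing R] (k : ℕ) {s : ℕ} (a : Fin s → ℤ) (x : Fin s → R) : R :=
  ∑ j, (a j : R) * x j ^ k

open scoped Classical in
/-- The number of zeros of the diagonal form modulo `p ^ h` that have a unit among the coordinates
in `J`. -/
noncomputable def unitZeroCount (k : ℕ) {s : ℕ} (a : Fin s → ℤ) (p h : ℕ) [NeZero (p ^ h)]
    (J : Finset (Fin s)) : ℕ :=
  (Finset.univ.filter fun x : Fin s → ZMod (p ^ h) =>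
    diagForm k a x = 0 ∧ ∃ j ∈ J, IsUnit (x j)).card

lemma powReduction_surjective (p : ℕ) {m n : ℕ} (hmn : m ≤ n) :
    Function.Surjective (powReduction p hmn) :=
  ZMod.castHom_surjective (pow_dvd_pow p hmn)

lemma map_diagForm {R S : Type*} [CommRing R] [CommRing S] (φ : R →+* S) (k : ℕ) {s : ℕ}
    (a : Fin s → ℤ) (x : Fin s → R) :
    φ (diagForm k a x) = diagForm k a fun j => φ (x j) := by
  simp [diagForm]

open scoped Classical in
lemma congruenceCount_eq (k : ℕ) {s : ℕ} (a : Fin s → ℤ) (p h : ℕ) [NeZero (p ^ h)] :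
    congruenceCount k a p h =
      (Finset.univ.filter fun x : Fin s → ZMod (p ^ h) => diagForm k a x = 0).card := by
  have hpos : (0 : ℤ) < (p : ℤ) ^ h := by
    have := Nat.pos_of_ne_zero (NeZero.ne (p ^ h))
    exact_mod_cast this
  have key : ∀ x : Fin s → ℤ, (∑ j, a j * x j ^ k) ≡ 0 [ZMOD (p : ℤ) ^ h] ↔
      diagForm k a (fun j => (x j : ZMod (p ^ h))) = 0 := by
    intro x
    have := ZMod.intCast_eq_intCast_iff (∑ j, a j * x j ^ k) 0 (p ^ h)
    push_cast at this
    rw [← this, diagForm]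
  unfold congruenceCount
  refine Finset.card_bij (fun x _ j => (x j : ZMod (p ^ h))) ?_ ?_ ?_
  · intro x hx
    simpa [key] using (Finset.mem_filter.1 hx).2
  · intro x hx y hy hxy
    ext j
    have hx' := Fintype.mem_piFinset.1 (Finset.mem_filter.1 hx).1 j
    have hy' := Fintype.mem_piFinset.1 (Finset.mem_filter.1 hy).1 j
    rw [Finset.mem_Icc] at hx' hy'
    have h1 := (ZMod.intCast_eq_intCast_iff _ _ _).1 (congrFun hxy j)
    have h2 := h1.dvd
    push_cast at h2
    obtain ⟨c, hc⟩ := h2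
    have : c = 0 := by
      by_contra hne
      rcases lt_or_gt_of_ne hne with h3 | h3 <;> nlinarith
    subst this
    linarith
  · intro y hy
    -- the representative of `y j` in `[1, p ^ h]`, obtained by shifting `y j - 1`
    have hfun : (fun j => ((((y j - 1).val : ℤ) + 1 : ℤ) : ZMod (p ^ h))) = y := by
      ext j
      push_cast
      rw [ZMod.natCast_zmod_val]
      ring
    refine ⟨fun j => ((y j - 1).val : ℤ) + 1, ?_, hfun⟩
    rw [Finset.mem_filter, key, hfun, Fintype.mem_piFinset]
    refine ⟨fun j => ?_, (Finset.mem_filter.1 hy).2⟩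
    rw [Finset.mem_Icc]
    have h1 : ((y j - 1).val : ℤ) < (p : ℤ) ^ h := by
      exact_mod_cast ZMod.val_lt (y j - 1)
    constructor <;> omega

lemma sum_comp_surjective {G H : Type*} [AddGroup G] [AddGroup H] [Fintype G] [Fintype H]
    (π : G →+ H) (hπ : Function.Surjective π) (φ : H → ℕ) :
    Fintype.card H * ∑ x, φ (π x) = Fintype.card G * ∑ y, φ y := by
  classical
  set c := (Finset.univ.filter fun x => π x = 0).card
  have hc : ∀ y, (Finset.univ.filter fun x => π x = y).card = c := fun y =>
    AddMonoidHom.card_fiber_eq_of_mem_range π (hπ y) (hπ 0)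
  have h1 : ∀ ψ : H → ℕ, ∑ x, ψ (π x) = c * ∑ y, ψ y := by
    intro ψ
    rw [← Finset.sum_fiberwise_of_maps_to (s := Finset.univ) (t := Finset.univ) (g := π)
      (fun _ _ => Finset.mem_univ _), Finset.mul_sum]
    refine Finset.sum_congr rfl fun y _ => ?_
    rw [Finset.sum_congr rfl (g := fun _ => ψ y), Finset.sum_const, hc, smul_eq_mul]
    intro x hx
    rw [(Finset.mem_filter.1 hx).2]
  have h2 := h1 fun _ => 1
  simp only [Finset.sum_const, Finset.card_univ, smul_eq_mul, mul_one] at h2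
  rw [h1, h2]
  ring

lemma sum_comp_powReduction (p : ℕ) {m n : ℕ} (hmn : m ≤ n) [NeZero (p ^ n)] [NeZero (p ^ m)]
    (φ : ZMod (p ^ m) → ℕ) :
    p ^ m * ∑ x, φ (powReduction p hmn x) = p ^ n * ∑ y, φ y := by
  have := sum_comp_surjective (powReduction p hmn).toAddMonoidHom
    (powReduction_surjective p hmn) φ
  simpa [ZMod.card] using this

lemma sum_comp_powReduction_pi (p : ℕ) {m n : ℕ} (hmn : m ≤ n) [NeZero (p ^ n)] [NeZero (p ^ m)]
    (s : ℕ) (φ : (Fin s → ZMod (p ^ m)) → ℕ) :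
    (p ^ m) ^ s * ∑ x : Fin s → ZMod (p ^ n), φ (fun j => powReduction p hmn (x j)) =
      (p ^ n) ^ s * ∑ y, φ y := by
  have := sum_comp_surjective
    (AddMonoidHom.compLeft (powReduction p hmn).toAddMonoidHom (Fin s))
    (fun y => ⟨fun j => (powReduction_surjective p hmn (y j)).choose, funext fun j =>
      (powReduction_surjective p hmn (y j)).choose_spec⟩) φ
  have hφ : ∀ x, (AddMonoidHom.compLeft (powReduction p hmn).toAddMonoidHom (Fin s)) x =
      fun j => powReduction p hmn (x j) := fun _ => rfl
  simpa only [hφ, Fintype.card_pi, ZMod.card, Finset.prod_const, Finset.card_univ,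
    Fintype.card_fin] using this

section Prime

variable {p : ℕ} [hp : Fact p.Prime]

lemma isUnit_zmod_pow_iff {h : ℕ} (hh : h ≠ 0) (n : ℤ) :
    IsUnit (n : ZMod (p ^ h)) ↔ ¬ (p : ℤ) ∣ n := by
  rw [ZMod.coe_int_isUnit_iff_isCoprime, Nat.cast_pow, IsCoprime.pow_left_iff (by omega),
    (Nat.prime_iff_prime_int.1 hp.out).coprime_iff_not_dvd]

lemma isUnit_powReduction_iff {m n : ℕ} (hm : m ≠ 0) (hmn : m ≤ n) (x : ZMod (p ^ n)) :
    IsUnit (powReduction p hmn x) ↔ IsUnit x := by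
  obtain ⟨z, rfl⟩ := ZMod.intCast_surjective x
  rw [map_intCast, isUnit_zmod_pow_iff hm, isUnit_zmod_pow_iff (by omega)]

/-! ### The number of unit solutions of `a t ^ k = c` -/

/-- A unit solution of `a t ^ k = c` modulo `p ^ h` gives one modulo every power of `p`: Hensel's
lemma in `ℤ_p` applies because the derivative `k a t ^ (k - 1)` has valuation at most `v` and
`h > 2 v`. -/
lemma exists_lift_pow_eq {k : ℕ} {a c : ℤ} {v h : ℕ} (hv : ¬ (p : ℤ) ^ (v + 1) ∣ k * a)
    (hh : 2 * v + 1 ≤ h) {t : ZMod (p ^ h)} (ht : IsUnit t) (hc : (a : ZMod (p ^ h)) * t ^ k = c)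
    (n : ℕ) :
    ∃ u : ZMod (p ^ n), IsUnit u ∧ (a : ZMod (p ^ n)) * u ^ k = c := by
  obtain ⟨z, rfl⟩ := ZMod.intCast_surjective t
  have hz : ¬ (p : ℤ) ∣ z := (isUnit_zmod_pow_iff (by omega) z).1 ht
  have hdvd : (p : ℤ) ^ h ∣ a * z ^ k - c := by
    have : (((a * z ^ k - c : ℤ)) : ZMod (p ^ h)) = 0 := by push_cast; rw [hc, sub_self]
    have := (ZMod.intCast_zmod_eq_zero_iff_dvd _ _).1 this
    exact_mod_cast this
  have hp1 : (1 : ℝ) < p := by exact_mod_cast hp.out.one_lt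
  have hp0 : (0 : ℝ) < p := by linarith
  have hznorm : ‖(z : ℤ_[p])‖ = 1 := by
    have h1 := (PadicInt.norm_int_lt_one_iff_dvd (p := p) z).not.2 hz
    exact le_antisymm (PadicInt.norm_le_one _) (not_lt.1 h1)
  let F : Polynomial ℤ_[p] := Polynomial.C (a : ℤ_[p]) * Polynomial.X ^ k - Polynomial.C (c : ℤ_[p])
  have hF : F.aeval (z : ℤ_[p]) = ((a * z ^ k - c : ℤ) : ℤ_[p]) := by simp [F]
  have hF' : F.derivative.aeval (z : ℤ_[p]) = ((k * a : ℤ) : ℤ_[p]) * (z : ℤ_[p]) ^ (k - 1) := by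
    simp [F, Polynomial.derivative_X_pow]
    ring
  have hd : (p : ℝ) ^ (-(v : ℤ)) ≤ ‖F.derivative.aeval (z : ℤ_[p])‖ := by
    rw [hF', norm_mul, norm_pow, hznorm, one_pow, mul_one]
    by_contra hlt
    refine hv ((PadicInt.norm_int_le_pow_iff_dvd (p := p)).1 ?_)
    have := (PadicInt.norm_le_pow_iff_norm_lt_pow_add_one (p := p) ((k * a : ℤ) : ℤ_[p])
      (-((v + 1 : ℕ) : ℤ))).2 (by push_cast at hlt ⊢; simpa using not_le.1 hlt)
    exact this
  have hnorm : ‖F.aeval (z : ℤ_[p])‖ < ‖F.derivative.aeval (z : ℤ_[p])‖ ^ 2 := by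
    calc ‖F.aeval (z : ℤ_[p])‖ ≤ (p : ℝ) ^ (-(h : ℤ)) := by
          rw [hF]; exact (PadicInt.norm_int_le_pow_iff_dvd (p := p)).2 hdvd
      _ < (p : ℝ) ^ (-(2 * v : ℤ)) := zpow_lt_zpow_right₀ hp1 (by omega)
      _ = ((p : ℝ) ^ (-(v : ℤ))) ^ 2 := by rw [← zpow_natCast, ← zpow_mul]; congr 1; push_cast; ring
      _ ≤ _ := by gcongr
  obtain ⟨w, hw, hwz, -⟩ := hensels_lemma hnorm
  have hwunit : IsUnit w := by
    rw [PadicInt.isUnit_iff]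
    have hlt : ‖w - z‖ < 1 := hwz.trans_le (PadicInt.norm_le_one _)
    have := PadicInt.norm_add_eq_max_of_ne (p := p) (q := w - z) (r := z) (by rw [hznorm]; exact hlt.ne)
    rw [sub_add_cancel, hznorm, max_eq_right hlt.le] at this
    exact this
  refine ⟨PadicInt.toZModPow n w, hwunit.map _, ?_⟩
  have := congrArg (PadicInt.toZModPow n) hw
  simp only [F, map_sub, map_mul, map_pow, Polynomial.aeval_X, map_zero,
    sub_eq_zero, map_intCast] at this
  exact this

open scoped Classical in
/-- The number of units `t` modulo `p ^ h` with `a t ^ k = c`. -/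
noncomputable def unitPowFiber (k : ℕ) (a : ℤ) {h : ℕ} (c : ZMod (p ^ h)) : ℕ :=
  (Finset.univ.filter fun t : ZMod (p ^ h) => IsUnit t ∧ (a : ZMod (p ^ h)) * t ^ k = c).card

open scoped Classical in
lemma unitPowFiber_eq_ite (k : ℕ) (a : ℤ) {h : ℕ} (c : ZMod (p ^ h)) :
    unitPowFiber k a c =
      if ∃ t : ZMod (p ^ h), IsUnit t ∧ (a : ZMod (p ^ h)) * t ^ k = c
        then unitPowFiber k a (a : ZMod (p ^ h)) else 0 := by
  split_ifs with hc
  · obtain ⟨u, hu, rfl⟩ := hc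
    obtain ⟨u, rfl⟩ := hu
    unfold unitPowFiber
    -- multiplication by `u` carries the solutions of `a t ^ k = a` to those of `a t ^ k = a u ^ k`
    refine (Finset.card_bij (fun t _ => (u : ZMod (p ^ h)) * t) ?_ ?_ ?_).symm
    · intro t ht
      obtain ⟨-, h1, h2⟩ := Finset.mem_filter.1 ht
      refine Finset.mem_filter.2 ⟨Finset.mem_univ _, u.isUnit.mul h1, ?_⟩
      rw [mul_pow, mul_left_comm, h2, mul_comm]
    · intro t _ t' _ h
      exact u.isUnit.mul_left_cancel h
    · intro t ht
      obtain ⟨-, h1, h2⟩ := Finset.mem_filter.1 ht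
      refine ⟨(u⁻¹ : (ZMod (p ^ h))ˣ) * t, Finset.mem_filter.2 ⟨Finset.mem_univ _,
        (u⁻¹).isUnit.mul h1, ?_⟩, by simp⟩
      rw [mul_pow, mul_left_comm, h2, mul_left_comm, ← mul_pow]
      simp
  · unfold unitPowFiber
    rw [Finset.card_eq_zero, Finset.filter_eq_empty_iff]
    intro t _ ht
    exact hc ⟨t, ht⟩

open scoped Classical in
lemma card_isUnit_zmod_pow {h : ℕ} (hh : h ≠ 0) :
    (Finset.univ.filter fun t : ZMod (p ^ h) => IsUnit t).card = p ^ (h - 1) * (p - 1) := by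
  rw [← Nat.totient_prime_pow hp.out (Nat.pos_of_ne_zero hh), ← ZMod.card_units_eq_totient,
    ← Fintype.card_subtype]
  exact Fintype.card_congr
    ⟨fun t => t.2.unit, fun u => ⟨u, u.isUnit⟩, fun t => by simp, fun u => by ext; simp⟩

/-- For large `h` the number of unit solutions of `a t ^ k = c` does not change when the modulus
is raised from `p ^ h` to `p ^ (h + 1)`: the set of `c` for which it is solvable modulo
`p ^ (h + 1)` is the full preimage of the one modulo `p ^ h`, all non-empty fibres have the same
size, and the total number of units grows by the factor `p`. -/
lemma unitPowFiber_succ {k : ℕ} {a : ℤ} {v h : ℕ} (hv : ¬ (p : ℤ) ^ (v + 1) ∣ k * a)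
    (hh : 2 * v + 1 ≤ h) (c : ZMod (p ^ (h + 1))) :
    unitPowFiber k a c = unitPowFiber k a (powReduction p h.le_succ c) := by
  classical
  have hiff : ∀ c : ZMod (p ^ (h + 1)),
      (∃ t : ZMod (p ^ (h + 1)), IsUnit t ∧ (a : ZMod (p ^ (h + 1))) * t ^ k = c) ↔
      ∃ t : ZMod (p ^ h), IsUnit t ∧ (a : ZMod (p ^ h)) * t ^ k = powReduction p h.le_succ c := by
    intro c
    constructor
    · rintro ⟨t, ht, rfl⟩
      exact ⟨powReduction p h.le_succ t, ht.map _, by simp⟩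
    · rintro ⟨t, ht, htc⟩
      obtain ⟨c, rfl⟩ := ZMod.intCast_surjective c
      rw [map_intCast] at htc
      exact exists_lift_pow_eq hv hh ht htc (h + 1)
  have htot : ∀ n : ℕ, n ≠ 0 → ∑ c : ZMod (p ^ n), unitPowFiber k a c = p ^ (n - 1) * (p - 1) := by
    intro n hn
    rw [← card_isUnit_zmod_pow hn, Finset.card_eq_sum_card_fiberwise
      (f := fun t : ZMod (p ^ n) => (a : ZMod (p ^ n)) * t ^ k) (t := Finset.univ)
      (fun _ _ => Finset.mem_univ _)]
    simp only [unitPowFiber, Finset.filter_filter]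
  have h1 := htot (h + 1) (by omega)
  have h2 := htot h (by omega)
  have hconst : unitPowFiber k a (a : ZMod (p ^ (h + 1))) =
      unitPowFiber k a (a : ZMod (p ^ h)) := by
    have hsum := sum_comp_powReduction p h.le_succ
      (fun c : ZMod (p ^ h) => if ∃ t : ZMod (p ^ h), IsUnit t ∧ (a : ZMod (p ^ h)) * t ^ k = c
        then 1 else 0)
    simp_rw [← hiff] at hsum
    have hfac : ∀ n : ℕ, ∑ c : ZMod (p ^ n), unitPowFiber k a c =
        unitPowFiber k a (a : ZMod (p ^ n)) * ∑ c : ZMod (p ^ n),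
          if ∃ t : ZMod (p ^ n), IsUnit t ∧ (a : ZMod (p ^ n)) * t ^ k = c then 1 else 0 := by
      intro n
      rw [Finset.mul_sum]
      refine Finset.sum_congr rfl fun c _ => ?_
      rw [unitPowFiber_eq_ite, mul_boole]
    rw [hfac] at h1 h2
    set X := ∑ c : ZMod (p ^ (h + 1)),
      if ∃ t : ZMod (p ^ (h + 1)), IsUnit t ∧ (a : ZMod (p ^ (h + 1))) * t ^ k = c then 1 else 0
    set Y := ∑ c : ZMod (p ^ h),
      if ∃ t : ZMod (p ^ h), IsUnit t ∧ (a : ZMod (p ^ h)) * t ^ k = c then 1 else 0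
    have hp1 := hp.out.one_lt
    have hXY : X = p * Y := by
      have : 0 < p ^ h := pow_pos hp.out.pos h
      refine Nat.eq_of_mul_eq_mul_left this ?_
      rw [hsum, Nat.pow_succ]
      ring
    have hY : 0 < p * Y := by
      rcases Nat.eq_zero_or_pos Y with h0 | h0
      · rw [h0, mul_zero] at h2
        have : 0 < p ^ (h - 1) * (p - 1) := Nat.mul_pos (pow_pos hp.out.pos _) (by omega)
        omega
      · exact Nat.mul_pos hp.out.pos h0
    refine Nat.eq_of_mul_eq_mul_right hY ?_
    rw [← hXY, h1, hXY, mul_left_comm, h2, ← mul_assoc, ← pow_succ']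
    congr 2
    omega
  rw [unitPowFiber_eq_ite, unitPowFiber_eq_ite (c := powReduction p h.le_succ c), hconst]
  simp only [hiff]

end Prime

/-! ### Stabilization of the number of zeros with a unit coordinate -/

section Prime

variable {p : ℕ} [hp : Fact p.Prime]

open scoped Classical in
/-- The number of zeros of the diagonal form modulo `p ^ h` whose unit coordinates are exactly those
in `B`. -/
noncomputable def patternZeroCount (k : ℕ) {s : ℕ} (a : Fin s → ℤ) (p h : ℕ) [NeZero (p ^ h)]
    (B : Finset (Fin s)) : ℕ :=
  (Finset.univ.filter fun x : Fin s → ZMod (p ^ h) =>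
    diagForm k a x = 0 ∧ ∀ j, IsUnit (x j) ↔ j ∈ B).card

open scoped Classical in
/-- Counting the zeros with unit pattern `B` by fixing all coordinates but one in `B`. -/
lemma patternZeroCount_eq_sum (k : ℕ) {n : ℕ} (a : Fin (n + 1) → ℤ) (h : ℕ)
    {B : Finset (Fin (n + 1))} {i : Fin (n + 1)} (hi : i ∈ B) :
    patternZeroCount k a p h B = ∑ y : Fin n → ZMod (p ^ h),
      if ∀ j, IsUnit (y j) ↔ i.succAbove j ∈ B then
        unitPowFiber k (a i) (-diagForm k (fun j => a (i.succAbove j)) y) else 0 := by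
  unfold patternZeroCount
  rw [Finset.card_filter, ← (Fin.insertNthEquiv (fun _ => ZMod (p ^ h)) i).sum_comp,
    Fintype.sum_prod_type_right]
  refine Finset.sum_congr rfl fun y _ => ?_
  have hform : ∀ t : ZMod (p ^ h),
      diagForm k a (Fin.insertNthEquiv (fun _ => ZMod (p ^ h)) i (t, y)) = 0 ↔
      (a i : ZMod (p ^ h)) * t ^ k = -diagForm k (fun j => a (i.succAbove j)) y := by
    intro t
    rw [diagForm, Fin.sum_univ_succAbove _ i, eq_neg_iff_add_eq_zero]
    simp [diagForm]
  have hpat : ∀ t : ZMod (p ^ h),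
      (∀ j, IsUnit (Fin.insertNthEquiv (fun _ => ZMod (p ^ h)) i (t, y) j) ↔ j ∈ B) ↔
      IsUnit t ∧ ∀ j, IsUnit (y j) ↔ i.succAbove j ∈ B := by
    intro t
    rw [Fin.forall_iff_succAbove i]
    simp [hi]
  simp only [hform, hpat, unitPowFiber, Finset.card_filter]
  split_ifs with hy
  · refine Finset.sum_congr rfl fun t _ => ?_
    simp [hy, and_comm]
  · simp [hy]

lemma patternZeroCount_succ {k s : ℕ} {a : Fin s → ℤ} {v h : ℕ} {B : Finset (Fin s)} {i : Fin s}
    (hi : i ∈ B) (hv : ¬ (p : ℤ) ^ (v + 1) ∣ k * a i) (hh : 2 * v + 1 ≤ h) :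
    patternZeroCount k a p (h + 1) B = p ^ (s - 1) * patternZeroCount k a p h B := by
  classical
  obtain _ | n := s
  · exact i.elim0
  rw [patternZeroCount_eq_sum k a _ hi, patternZeroCount_eq_sum k a _ hi, Nat.add_sub_cancel]
  have hpos : 0 < (p ^ h) ^ n := pow_pos (pow_pos hp.out.pos h) n
  refine Nat.eq_of_mul_eq_mul_left hpos ?_
  have := sum_comp_powReduction_pi p h.le_succ n (fun y : Fin n → ZMod (p ^ h) =>
    if ∀ j, IsUnit (y j) ↔ i.succAbove j ∈ B then
        unitPowFiber k (a i) (-diagForm k (fun j => a (i.succAbove j)) y) else 0)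
  simp only [isUnit_powReduction_iff (p := p) (show h ≠ 0 by omega), ← map_diagForm, ← map_neg,
    ← unitPowFiber_succ hv hh] at this
  rw [this, Nat.pow_succ, mul_pow, mul_assoc]

lemma unitZeroCount_eq_sum (k : ℕ) {s : ℕ} (a : Fin s → ℤ) (h : ℕ) (J : Finset (Fin s)) :
    unitZeroCount k a p h J =
      ∑ B ∈ Finset.univ.filter (fun B : Finset (Fin s) => ∃ j ∈ J, j ∈ B),
        patternZeroCount k a p h B := by
  classical
  unfold unitZeroCount
  rw [Finset.card_eq_sum_card_fiberwise
    (f := fun x : Fin s → ZMod (p ^ h) => Finset.univ.filter fun j => IsUnit (x j))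
    (t := Finset.univ.filter (fun B : Finset (Fin s) => ∃ j ∈ J, j ∈ B))]
  · refine Finset.sum_congr rfl fun B hB => ?_
    unfold patternZeroCount
    congr 1
    ext x
    obtain ⟨j, hjJ, hjB⟩ := (Finset.mem_filter.1 hB).2
    simp only [Finset.mem_filter, Finset.mem_univ, true_and, Finset.ext_iff]
    exact ⟨fun hx => ⟨hx.1.1, hx.2⟩, fun hx => ⟨⟨hx.1, j, hjJ, (hx.2 j).2 hjB⟩, hx.2⟩⟩
  · intro x hx
    simpa using (Finset.mem_filter.1 hx).2.2

lemma unitZeroCount_succ {k s : ℕ} {a : Fin s → ℤ} {v h : ℕ} {J : Finset (Fin s)}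
    (hv : ∀ j ∈ J, ¬ (p : ℤ) ^ (v + 1) ∣ k * a j) (hh : 2 * v + 1 ≤ h) :
    unitZeroCount k a p (h + 1) J = p ^ (s - 1) * unitZeroCount k a p h J := by
  rw [unitZeroCount_eq_sum, unitZeroCount_eq_sum, Finset.mul_sum]
  refine Finset.sum_congr rfl fun B hB => ?_
  obtain ⟨j, hjJ, hjB⟩ := (Finset.mem_filter.1 hB).2
  exact patternZeroCount_succ hjB (hv j hjJ) hh

lemma unitZeroCount_add {k s : ℕ} {a : Fin s → ℤ} {v h : ℕ} {J : Finset (Fin s)}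
    (hv : ∀ j ∈ J, ¬ (p : ℤ) ^ (v + 1) ∣ k * a j) (hh : 2 * v + 1 ≤ h) (n : ℕ) :
    unitZeroCount k a p (h + n) J = p ^ (n * (s - 1)) * unitZeroCount k a p h J := by
  induction n with
  | zero => simp
  | succ n ih =>
    rw [← add_assoc, unitZeroCount_succ hv (by omega), ih, ← mul_assoc, ← pow_add]
    congr 2
    ring

open scoped Classical in
lemma card_filter_diagForm_eq_zero (k : ℕ) {s : ℕ} (a : Fin s → ℤ) (h : ℕ) :
    (Finset.univ.filter fun x : Fin s → ZMod (p ^ h) => diagForm k a x = 0).card =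
      unitZeroCount k a p h Finset.univ + (Finset.univ.filter fun x : Fin s → ZMod (p ^ h) =>
        diagForm k a x = 0 ∧ ∀ j, ¬ IsUnit (x j)).card := by
  rw [← Finset.card_filter_add_card_filter_not (fun x => ∃ j, IsUnit (x j)), Finset.filter_filter,
    Finset.filter_filter]
  simp [unitZeroCount]

lemma not_isUnit_zmod_pow_iff {h : ℕ} (hh : h ≠ 0) (x : ZMod (p ^ h)) :
    ¬ IsUnit x ↔ ∃ y, (p : ZMod (p ^ h)) * y = x := by
  obtain ⟨z, rfl⟩ := ZMod.intCast_surjective x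
  constructor
  · intro hz
    rw [isUnit_zmod_pow_iff hh, not_not] at hz
    obtain ⟨c, rfl⟩ := hz
    exact ⟨c, by push_cast; rfl⟩
  · rintro ⟨y, hy⟩ hu
    rw [← hy] at hu
    have := isUnit_of_mul_isUnit_left hu
    have h2 := (isUnit_zmod_pow_iff (p := p) hh (p : ℤ)).1 (by exact_mod_cast this)
    exact h2 dvd_rfl

open scoped Classical in
lemma card_not_isUnit_zmod_pow {h : ℕ} (hh : h ≠ 0) :
    (Finset.univ.filter fun t : ZMod (p ^ h) => ¬ IsUnit t).card = p ^ (h - 1) := by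
  have h1 := Finset.card_filter_add_card_filter_not (s := (Finset.univ : Finset (ZMod (p ^ h))))
    (fun t => IsUnit t)
  rw [card_isUnit_zmod_pow hh, Finset.card_univ, ZMod.card] at h1
  have h2 : p ^ h = p ^ (h - 1) * (p - 1) + p ^ (h - 1) := by
    obtain ⟨n, rfl⟩ := Nat.exists_eq_succ_of_ne_zero hh
    obtain ⟨q, rfl⟩ := Nat.exists_eq_succ_of_ne_zero hp.out.ne_zero
    simp [Nat.pow_succ, Nat.mul_succ]
  omega

open scoped Classical in
/-- The zeros without unit coordinates are the multiples `p y`, and `p y` is a zero modulo `p ^ h`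
exactly when `y` is one modulo `p ^ (h - k)`. -/
lemma card_nonunit_zeros {k s : ℕ} (hk : k ≠ 0) (a : Fin s → ℤ) (h : ℕ) :
    p ^ s * (Finset.univ.filter fun x : Fin s → ZMod (p ^ (h + k)) =>
        diagForm k a x = 0 ∧ ∀ j, ¬ IsUnit (x j)).card =
      p ^ (k * s) * (Finset.univ.filter fun x : Fin s → ZMod (p ^ h) => diagForm k a x = 0).card := by
  let μ : (Fin s → ZMod (p ^ (h + k))) →+ (Fin s → ZMod (p ^ (h + k))) := AddMonoidHom.mulLeft (fun _ => (p : ZMod (p ^ (h + k))))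
  have hμ : ∀ x j, μ x j = p * x j := fun _ _ => rfl
  have hrange : ∀ x : Fin s → ZMod (p ^ (h + k)), (∀ j, ¬ IsUnit (x j)) ↔ x ∈ μ.range := by
    intro x
    simp only [not_isUnit_zmod_pow_iff (p := p) (h := h + k) (by omega)]
    constructor
    · intro hx
      choose y hy using hx
      exact ⟨y, funext hy⟩
    · rintro ⟨y, rfl⟩ j
      exact ⟨y j, rfl⟩
  have hsub : ∀ φ : (Fin s → ZMod (p ^ (h + k))) → ℕ, ∑ x : μ.range, φ x =
      ∑ x with ∀ j, ¬ IsUnit (x j), φ x := fun φ =>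
    (Finset.sum_subtype _ (fun x => by simpa using hrange x) φ).symm
  have hcard : Fintype.card μ.range = (p ^ (h + k - 1)) ^ s := by
    have := hsub fun _ => 1
    rw [Finset.sum_const, Finset.card_univ, Finset.sum_const, smul_eq_mul, smul_eq_mul, mul_one,
      mul_one] at this
    rw [this, ← card_not_isUnit_zmod_pow (p := p) (h := h + k) (by omega),
      show (Finset.univ.filter fun x : Fin s → ZMod (p ^ (h + k)) => ∀ j, ¬ IsUnit (x j)) =
        Fintype.piFinset fun _ => Finset.univ.filter fun t : ZMod (p ^ (h + k)) => ¬ IsUnit t by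
          ext x; simp only [Fintype.mem_piFinset, Finset.mem_filter, Finset.mem_univ, true_and]]
    simp only [Fintype.card_piFinset, Finset.prod_const, Finset.card_univ, Fintype.card_fin]
  have h1 := sum_comp_surjective μ.rangeRestrict μ.rangeRestrict_surjective
    (fun x => if diagForm k a (x : Fin s → ZMod (p ^ (h + k))) = 0 then 1 else 0)
  have h2 : ∑ x : μ.range, (if diagForm k a (x : Fin s → ZMod (p ^ (h + k))) = 0 then 1 else 0) =
      (Finset.univ.filter fun x : Fin s → ZMod (p ^ (h + k)) =>
        diagForm k a x = 0 ∧ ∀ j, ¬ IsUnit (x j)).card := by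
    rw [hsub fun x => if diagForm k a x = 0 then 1 else 0, ← Finset.card_filter,
      Finset.filter_filter]
    simp only [and_comm]
  have h3 : ∀ y : Fin s → ZMod (p ^ (h + k)), diagForm k a (μ y) = 0 ↔
      diagForm k a (fun j => powReduction p (Nat.le_add_right h k) (y j)) = 0 := by
    intro y
    choose z hz using fun j => ZMod.intCast_surjective (y j)
    have e1 : diagForm k a (μ y) = (((p : ℤ) ^ k * diagForm k a z : ℤ) : ZMod (p ^ (h + k))) := by
      simp only [diagForm, hμ, ← hz, Finset.mul_sum]
      push_cast
      refine Finset.sum_congr rfl fun j _ => ?_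
      ring
    have e2 : diagForm k a (fun j => powReduction p (Nat.le_add_right h k) (y j)) =
        ((diagForm k a z : ℤ) : ZMod (p ^ h)) := by
      simp [diagForm, ← hz]
    rw [e1, e2, ZMod.intCast_zmod_eq_zero_iff_dvd, ZMod.intCast_zmod_eq_zero_iff_dvd]
    push_cast
    rw [pow_add, mul_comm]
    exact mul_dvd_mul_iff_left (pow_ne_zero k (by exact_mod_cast hp.out.ne_zero))
  have h4 := sum_comp_powReduction_pi p (Nat.le_add_right h k) s
    (fun y => if diagForm k a y = 0 then 1 else 0)
  simp only [AddMonoidHom.coe_rangeRestrict, h3, hcard, h2, Fintype.card_pi, ZMod.card,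
    Finset.prod_const, Finset.card_univ, Fintype.card_fin] at h1
  simp only [Finset.card_filter] at h1 h4 ⊢
  have hp0 := hp.out.pos
  have e : (p ^ (h + k)) ^ s = p ^ s * (p ^ (h + k - 1)) ^ s := by
    rw [← mul_pow, ← pow_succ']
    congr 2
    omega
  have e2 : (p ^ (h + k)) ^ s = (p ^ h) ^ s * p ^ (k * s) := by
    rw [pow_mul, ← mul_pow, ← pow_add]
  have cancel : ∀ {A B S K X N T : ℕ}, 0 < A * B → B * T = S * B * X → A * T = A * K * N →
      S * X = K * N := fun {A B S K X N T} h0 hB hA => by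
    refine Nat.eq_of_mul_eq_mul_left h0 ?_
    calc A * B * (S * X) = A * (B * T) := by rw [hB]; ring
      _ = A * B * (K * N) := by rw [mul_left_comm, hA]; ring
  rw [e] at h1
  rw [e2] at h4
  exact cancel (by positivity) h1 h4

end Prime

/-! ### The local densities -/

lemma tendsto_zero_of_contraction {E : ℕ → ℝ} {k H : ℕ} {ρ : ℝ} (hk : k ≠ 0) (hρ0 : 0 ≤ ρ)
    (hρ1 : ρ < 1) (hE : ∀ h, H ≤ h → E (h + k) = ρ * E h) :
    Filter.Tendsto E Filter.atTop (nhds 0) := by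
  have hiter : ∀ q h, H ≤ h → E (h + q * k) = ρ ^ q * E h := by
    intro q
    induction q with
    | zero => simp
    | succ q ih =>
      intro h hh
      rw [Nat.succ_mul, ← add_assoc, hE _ (by omega), ih h hh, pow_succ]
      ring
  set B := ∑ r ∈ Finset.range k, |E (H + r)|
  have hbound : ∀ h, |E (h + H)| ≤ ρ ^ (h / k) * B := by
    intro h
    have h1 : h + H = H + h % k + h / k * k := by
      have := Nat.mod_add_div h k
      rw [mul_comm] at this
      omega
    rw [h1, hiter _ _ (by omega), abs_mul, abs_of_nonneg (pow_nonneg hρ0 _)]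
    gcongr
    exact Finset.single_le_sum (f := fun r => |E (H + r)|) (fun _ _ => abs_nonneg _)
      (Finset.mem_range.2 (Nat.mod_lt _ (Nat.pos_of_ne_zero hk)))
  rw [← Filter.tendsto_add_atTop_iff_nat H]
  refine squeeze_zero_norm hbound ?_
  have h1 : Filter.Tendsto (fun h : ℕ => ρ ^ (h / k)) Filter.atTop (nhds 0) :=
    (tendsto_pow_atTop_nhds_zero_of_lt_one hρ0 hρ1).comp
      (Nat.tendsto_div_const_atTop hk)
  simpa using h1.mul_const B

section Prime

variable {p : ℕ} [hp : Fact p.Prime]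

/-- The normalised number of zeros with a unit coordinate in `J`. -/
noncomputable def unitDensity (k : ℕ) {s : ℕ} (a : Fin s → ℤ) (p h : ℕ) [NeZero (p ^ h)]
    (J : Finset (Fin s)) : ℝ :=
  (p : ℝ) ^ ((h : ℤ) * (1 - (s : ℤ))) * (unitZeroCount k a p h J : ℝ)

lemma unitDensity_stable {k s : ℕ} (hs : s ≠ 0) {a : Fin s → ℤ} {v h : ℕ} {J : Finset (Fin s)}
    (hv : ∀ j ∈ J, ¬ (p : ℤ) ^ (v + 1) ∣ k * a j) (hh : 2 * v + 1 ≤ h) :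
    unitDensity k a p h J = unitDensity k a p (2 * v + 1) J := by
  obtain ⟨n, rfl⟩ := Nat.exists_eq_add_of_le hh
  have hp0 : (p : ℝ) ≠ 0 := by exact_mod_cast hp.out.ne_zero
  unfold unitDensity
  rw [unitZeroCount_add hv le_rfl]
  push_cast
  rw [← zpow_natCast, ← mul_assoc, ← zpow_add₀ hp0]
  congr 2
  push_cast [Nat.cast_sub (Nat.one_le_iff_ne_zero.2 hs)]
  ring

lemma unitDensity_le_normalizedCount (k : ℕ) {s : ℕ} (a : Fin s → ℤ) (h : ℕ)
    (J : Finset (Fin s)) : unitDensity k a p h J ≤ normalizedCount k a p h := by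
  classical
  unfold unitDensity normalizedCount
  gcongr
  rw [congruenceCount_eq]
  exact Finset.card_le_card fun x hx => by
    simp only [Finset.mem_filter] at hx ⊢
    exact ⟨hx.1, hx.2.1⟩

lemma normalizedCount_add {k s : ℕ} (hk : k ≠ 0) (a : Fin s → ℤ) (h : ℕ) :
    normalizedCount k a p (h + k) = unitDensity k a p (h + k) Finset.univ +
      (p : ℝ) ^ ((k : ℤ) - s) * normalizedCount k a p h := by
  classical
  have hp0 : (p : ℝ) ≠ 0 := by exact_mod_cast hp.out.ne_zero
  have h1 := card_nonunit_zeros (p := p) hk a h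
  unfold normalizedCount unitDensity
  rw [congruenceCount_eq, congruenceCount_eq, card_filter_diagForm_eq_zero]
  set X := (Finset.univ.filter fun x : Fin s → ZMod (p ^ (h + k)) =>
        diagForm k a x = 0 ∧ ∀ j, ¬ IsUnit (x j)).card
  set N := (Finset.univ.filter fun x : Fin s → ZMod (p ^ h) => diagForm k a x = 0).card
  have h2 : (p : ℝ) ^ (s : ℤ) * X = (p : ℝ) ^ ((k : ℤ) * s) * N := by
    have := congrArg (Nat.cast (R := ℝ)) h1
    push_cast at this
    rw [← zpow_natCast, ← zpow_natCast] at this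
    exact_mod_cast this
  have h3 : (X : ℝ) = (p : ℝ) ^ ((k : ℤ) * s - s) * N := by
    rw [zpow_sub₀ hp0, div_mul_eq_mul_div, ← h2, mul_div_cancel_left₀ _ (zpow_ne_zero _ hp0)]
  push_cast
  rw [mul_add, h3, ← mul_assoc, ← mul_assoc, ← zpow_add₀ hp0, ← zpow_add₀ hp0]
  congr 3
  ring

/-- The normalised counts satisfy `M_{h+k} = P + p ^ (k - s) M_h` for large `h`, so they converge to
the fixed point of this contraction. -/
lemma tendsto_normalizedCount {k s : ℕ} (hk : k ≠ 0) (hks : k < s) {a : Fin s → ℤ} {v : ℕ}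
    (hv : ∀ j, ¬ (p : ℤ) ^ (v + 1) ∣ k * a j) :
    Filter.Tendsto (fun h => normalizedCount k a p h) Filter.atTop
      (nhds (unitDensity k a p (2 * v + 1) Finset.univ / (1 - (p : ℝ) ^ ((k : ℤ) - s)))) := by
  set P := unitDensity k a p (2 * v + 1) Finset.univ
  set ρ := (p : ℝ) ^ ((k : ℤ) - s)
  have hp1 : (1 : ℝ) < p := by exact_mod_cast hp.out.one_lt
  have hρ0 : 0 ≤ ρ := by positivity
  have hρ1 : ρ < 1 := zpow_lt_one_of_neg₀ hp1 (by omega)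
  have h1ρ : 1 - ρ ≠ 0 := by linarith
  have h0 := tendsto_zero_of_contraction (E := fun h => normalizedCount k a p h - P / (1 - ρ))
    (H := 2 * v + 1) hk hρ0 hρ1 (by
      intro h hh
      have h2 := normalizedCount_add (p := p) hk a h
      rw [unitDensity_stable (by omega) (fun j _ => hv j) (show 2 * v + 1 ≤ h + k by omega)] at h2
      rw [h2]
      field_simp
      ring)
  simpa using h0.add_const (P / (1 - ρ))

lemma localDensity_eq {k s : ℕ} (hk : k ≠ 0) (hks : k < s) {a : Fin s → ℤ} {v : ℕ}
    (hv : ∀ j, ¬ (p : ℤ) ^ (v + 1) ∣ k * a j) :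
    localDensity k a p =
      unitDensity k a p (2 * v + 1) Finset.univ / (1 - (p : ℝ) ^ ((k : ℤ) - s)) :=
  (tendsto_normalizedCount hk hks hv).limUnder_eq

lemma exists_not_pow_dvd {k s : ℕ} (hk : k ≠ 0) {a : Fin s → ℤ} (ha : ∀ j, a j ≠ 0) :
    ∃ v : ℕ, ∀ j, ¬ (p : ℤ) ^ (v + 1) ∣ k * a j := by
  have h1 : ∀ j, ∃ n : ℕ, ¬ (p : ℤ) ^ (n + 1) ∣ k * a j := fun j =>
    FiniteMultiplicity.of_prime_left (Nat.prime_iff_prime_int.1 hp.out)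
      (mul_ne_zero (by exact_mod_cast hk) (ha j))
  choose n hn using h1
  refine ⟨∑ j, n j, fun j hj => hn j ((pow_dvd_pow _ ?_).trans hj)⟩
  have := Finset.single_le_sum (f := n) (fun _ _ => Nat.zero_le _) (Finset.mem_univ j)
  omega

lemma tendsto_localDensity {k s : ℕ} (hk : k ≠ 0) (hks : k < s) {a : Fin s → ℤ}
    (ha : ∀ j, a j ≠ 0) :
    Filter.Tendsto (fun h => normalizedCount k a p h) Filter.atTop (nhds (localDensity k a p)) := by
  obtain ⟨v, hv⟩ := exists_not_pow_dvd (p := p) hk ha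
  rw [localDensity_eq hk hks hv]
  exact tendsto_normalizedCount hk hks hv

lemma localDensity_nonneg {k s : ℕ} (hk : k ≠ 0) (hks : k < s) {a : Fin s → ℤ}
    (ha : ∀ j, a j ≠ 0) : 0 ≤ localDensity k a p :=
  ge_of_tendsto' (tendsto_localDensity hk hks ha) fun h => by
    unfold normalizedCount
    positivity

lemma unitDensity_le_localDensity {k s : ℕ} (hk : k ≠ 0) (hks : k < s) {a : Fin s → ℤ}
    (ha : ∀ j, a j ≠ 0) {v : ℕ} {J : Finset (Fin s)}
    (hv : ∀ j ∈ J, ¬ (p : ℤ) ^ (v + 1) ∣ k * a j) :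
    unitDensity k a p (2 * v + 1) J ≤ localDensity k a p := by
  refine ge_of_tendsto (tendsto_localDensity hk hks ha) ?_
  filter_upwards [Filter.eventually_ge_atTop (2 * v + 1)] with h hh
  rw [← unitDensity_stable (by omega) hv hh]
  exact unitDensity_le_normalizedCount k a h J

/-- A positive local density comes from at least one zero with a unit coordinate modulo
`p ^ (2 v + 1)`, which already forces an explicit lower bound. -/
lemma le_localDensity_of_pos {k s : ℕ} (hk : k ≠ 0) (hks : k < s) {a : Fin s → ℤ} {v : ℕ}
    (ha : ∀ j, a j ≠ 0)
    (hv : ∀ j, ¬ (p : ℤ) ^ (v + 1) ∣ k * a j) (hpos : 0 < localDensity k a p) :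
    (((p : ℝ) ^ (2 * v + 1)) ^ (s - 1))⁻¹ ≤ localDensity k a p := by
  refine le_trans ?_ (unitDensity_le_localDensity hk hks ha (J := Finset.univ) fun j _ => hv j)
  have h1 : unitZeroCount k a p (2 * v + 1) Finset.univ ≠ 0 := by
    intro h0
    rw [localDensity_eq hk hks hv, unitDensity, h0] at hpos
    simp at hpos
  have hp0 : (p : ℝ) ≠ 0 := by exact_mod_cast hp.out.ne_zero
  have h2 : (1 : ℝ) ≤ unitZeroCount k a p (2 * v + 1) Finset.univ := by
    exact_mod_cast Nat.one_le_iff_ne_zero.2 h1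
  have h3 : (((p : ℝ) ^ (2 * v + 1)) ^ (s - 1))⁻¹ =
      (p : ℝ) ^ (((2 * v + 1 : ℕ) : ℤ) * (1 - (s : ℤ))) := by
    rw [← pow_mul, ← zpow_natCast, ← zpow_neg]
    congr 1
    push_cast [Nat.cast_sub (show 1 ≤ s by omega)]
    ring
  rw [h3, unitDensity]
  exact le_mul_of_one_le_right (by positivity) h2

end Prime

/-! ### Power sums over prime fields and zeros modulo a prime -/

section PowerSums

variable {q : ℕ} [hq : Fact q.Prime]

/-- The exponential sum `∑ x, e(c x ^ k / q)` over the prime field `ℤ/q`. -/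
noncomputable def powSum (k : ℕ) (c : ZMod q) : ℂ :=
  ∑ x : ZMod q, ZMod.stdAddChar (c * x ^ k)

lemma norm_powSum_le_card (k : ℕ) (c : ZMod q) : ‖powSum k c‖ ≤ q := by
  refine (norm_sum_le _ _).trans ?_
  simp [ZMod.card]

lemma powSum_zero (k : ℕ) : powSum k (0 : ZMod q) = q := by
  simp [powSum, ZMod.card]

lemma card_pow_eq_le {k : ℕ} (hk : k ≠ 0) (c : ZMod q) :
    (Finset.univ.filter fun x : ZMod q => x ^ k = c).card ≤ k := by
  have hk' := Nat.pos_of_ne_zero hk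
  refine le_trans ?_ (Polynomial.card_nthRoots k c)
  refine le_trans (Finset.card_le_card (t := (Polynomial.nthRoots k c).toFinset) ?_)
    (Multiset.toFinset_card_le _)
  intro x hx
  simpa [Polynomial.mem_nthRoots hk'] using hx

/-- By orthogonality the left side is `q` times the number of solutions of `x ^ k = y ^ k`. -/
lemma sum_norm_powSum_sq_le {k : ℕ} (hk : k ≠ 0) :
    ∑ b : ZMod q, ‖powSum k b‖ ^ 2 ≤ k * (q : ℝ) ^ 2 := by
  have h1 : ∀ b : ZMod q, ((‖powSum k b‖ ^ 2 : ℝ) : ℂ) =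
      ∑ x : ZMod q, ∑ y : ZMod q, ZMod.stdAddChar (b * (x ^ k - y ^ k)) := by
    intro b
    rw [← Complex.normSq_eq_norm_sq, ← Complex.mul_conj, powSum, map_sum, Finset.sum_mul_sum]
    refine Finset.sum_congr rfl fun x _ => Finset.sum_congr rfl fun y _ => ?_
    rw [← AddChar.map_neg_eq_conj, ← AddChar.map_add_eq_mul]
    congr 1
    ring
  have h2 : ((∑ b : ZMod q, ‖powSum k b‖ ^ 2 : ℝ) : ℂ) =
      ((q * ∑ x : ZMod q, (Finset.univ.filter fun y : ZMod q => y ^ k = x ^ k).card : ℕ) : ℂ) := by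
    rw [Complex.ofReal_sum, Finset.sum_congr rfl fun b _ => h1 b, Finset.sum_comm]
    push_cast
    rw [Finset.mul_sum]
    refine Finset.sum_congr rfl fun x _ => ?_
    rw [Finset.sum_comm, Finset.card_filter]
    push_cast
    rw [Finset.mul_sum]
    refine Finset.sum_congr rfl fun y _ => ?_
    rw [AddChar.sum_mulShift _ (ZMod.isPrimitive_stdAddChar q)]
    simp [ZMod.card, sub_eq_zero, eq_comm]
  have h3 : ∑ b : ZMod q, ‖powSum k b‖ ^ 2 =
      ((q * ∑ x : ZMod q, (Finset.univ.filter fun y : ZMod q => y ^ k = x ^ k).card : ℕ) : ℝ) := by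
    exact_mod_cast h2
  rw [h3]
  have h4 : ∑ x : ZMod q, (Finset.univ.filter fun y : ZMod q => y ^ k = x ^ k).card ≤ q * k := by
    refine (Finset.sum_le_card_nsmul _ _ k fun x _ => card_pow_eq_le hk _).trans ?_
    simp [ZMod.card]
  calc ((q * ∑ x : ZMod q, (Finset.univ.filter fun y : ZMod q => y ^ k = x ^ k).card : ℕ) : ℝ)
      ≤ ((q * (q * k) : ℕ) : ℝ) := by exact_mod_cast Nat.mul_le_mul_left q h4
    _ = k * (q : ℝ) ^ 2 := by push_cast; ring

/-- The sum at `c` agrees with the sums at all `c t ^ k`, so it cannot exceed the mean square by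
much. -/
lemma norm_powSum_sq_le {k : ℕ} (hk : k ≠ 0) {c : ZMod q} (hc : c ≠ 0) :
    ‖powSum k c‖ ^ 2 ≤ 2 * (k : ℝ) ^ 2 * q := by
  have h1 : ∀ t : ZMod q, t ≠ 0 → powSum k (c * t ^ k) = powSum k c := by
    intro t ht
    unfold powSum
    refine Fintype.sum_equiv (Equiv.mulLeft₀ t ht) _ _ fun x => ?_
    simp [mul_pow, mul_assoc]
  have h2 : ∑ t ∈ (Finset.univ : Finset (ZMod q)).erase 0, ‖powSum k (c * t ^ k)‖ ^ 2 ≤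
      ∑ b : ZMod q, k * ‖powSum k b‖ ^ 2 := by
    rw [← Finset.sum_fiberwise_of_maps_to (g := fun t => c * t ^ k) (t := Finset.univ)
      (fun _ _ => Finset.mem_univ _)]
    refine Finset.sum_le_sum fun b _ => ?_
    rw [Finset.sum_congr rfl (g := fun _ => ‖powSum k b‖ ^ 2), Finset.sum_const, nsmul_eq_mul]
    · gcongr
      refine le_trans (Finset.card_le_card ?_) (card_pow_eq_le hk (b / c))
      intro t ht
      have := (Finset.mem_filter.1 ht).2
      simp only [Finset.mem_filter, Finset.mem_univ, true_and]
      rw [← this, mul_div_cancel_left₀ _ hc]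
    · intro t ht
      rw [(Finset.mem_filter.1 ht).2]
  rw [Finset.sum_congr rfl (g := fun _ => ‖powSum k c‖ ^ 2) fun t ht => by
      rw [h1 t (Finset.ne_of_mem_erase ht)], Finset.sum_const, Finset.card_erase_of_mem
      (Finset.mem_univ _), Finset.card_univ, ZMod.card, nsmul_eq_mul, ← Finset.mul_sum,
      Nat.cast_sub hq.out.one_le] at h2
  have h3 := sum_norm_powSum_sq_le (q := q) hk
  have h4 : (2 : ℝ) ≤ q := by exact_mod_cast hq.out.two_le
  have h5 : ((q : ℝ) - 1) * ‖powSum k c‖ ^ 2 ≤ k * (k * (q : ℝ) ^ 2) := by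
    push_cast at h2
    exact h2.trans (by gcongr)
  have h6 : (q : ℝ) / 2 * ‖powSum k c‖ ^ 2 ≤ ((q : ℝ) - 1) * ‖powSum k c‖ ^ 2 := by
    gcongr
    linarith
  have h7 : (q : ℝ) / 2 * ‖powSum k c‖ ^ 2 ≤ (q : ℝ) / 2 * (2 * (k : ℝ) ^ 2 * q) := by
    refine (h6.trans h5).trans (le_of_eq ?_)
    ring
  exact le_of_mul_le_mul_left h7 (by linarith)

lemma card_zeros_eq_sum_powSum (k : ℕ) {s : ℕ} (a : Fin s → ℤ) :
    (q : ℂ) * ((Finset.univ.filter fun x : Fin s → ZMod q => diagForm k a x = 0).card : ℂ) =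
      ∑ b : ZMod q, ∏ j, powSum k (b * (a j : ZMod q)) := by
  have h1 : ∀ b : ZMod q, ∏ j, powSum k (b * (a j : ZMod q)) =
      ∑ x : Fin s → ZMod q, ZMod.stdAddChar (b * diagForm k a x) := by
    intro b
    simp only [powSum]
    rw [Finset.prod_univ_sum, Fintype.piFinset_univ]
    refine Finset.sum_congr rfl fun x _ => ?_
    have h2 := map_prod (ZMod.stdAddChar (N := q)).toMonoidHom
      (fun j => Multiplicative.ofAdd (b * (a j * x j ^ k) : ZMod q)) Finset.univ
    simp only [AddChar.toMonoidHom_apply, ← ofAdd_sum, toAdd_ofAdd] at h2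
    rw [diagForm, Finset.mul_sum, h2]
    simp only [mul_assoc]
  rw [Finset.sum_congr rfl fun b _ => h1 b, Finset.sum_comm, Finset.card_filter]
  push_cast
  rw [Finset.mul_sum]
  refine Finset.sum_congr rfl fun x _ => ?_
  rw [AddChar.sum_mulShift _ (ZMod.isPrimitive_stdAddChar q)]
  simp [ZMod.card]

/-- If at most one coefficient, the `i`-th, vanishes modulo `q`, the number of zeros modulo `q` is
close to `q ^ (s - 1)`. -/
lemma abs_card_zeros_sub_le {k : ℕ} (hk : k ≠ 0) {n : ℕ} {a : Fin (n + 1) → ℤ} {i : Fin (n + 1)}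
    (ha : ∀ j, j ≠ i → (a j : ZMod q) ≠ 0) :
    |((Finset.univ.filter fun x : Fin (n + 1) → ZMod q => diagForm k a x = 0).card : ℝ) - q ^ n| ≤
      (√2 * k) ^ n * (q * √q ^ n) := by
  set N := (Finset.univ.filter fun x : Fin (n + 1) → ZMod q => diagForm k a x = 0).card
  have hq0 : (0 : ℝ) < q := by exact_mod_cast hq.out.pos
  have h1 := card_zeros_eq_sum_powSum (q := q) k a
  rw [← Finset.add_sum_erase _ _ (Finset.mem_univ (0 : ZMod q))] at h1
  simp only [zero_mul, powSum_zero, Finset.prod_const, Finset.card_univ, Fintype.card_fin] at h1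
  have h2 : ∀ c : ZMod q, c ≠ 0 → ‖powSum k c‖ ≤ √2 * k * √q := by
    intro c hc
    refine abs_le_of_sq_le_sq' ?_ (by positivity) |>.2
    refine (norm_powSum_sq_le hk hc).trans (le_of_eq ?_)
    rw [mul_pow, mul_pow, Real.sq_sqrt (by norm_num), Real.sq_sqrt hq0.le]
  have h3 : ∀ b ∈ (Finset.univ : Finset (ZMod q)).erase 0,
      ‖∏ j, powSum k (b * (a j : ZMod q))‖ ≤ q * (√2 * k * √q) ^ n := by
    intro b hb
    rw [Fin.prod_univ_succAbove _ i, norm_mul, norm_prod]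
    gcongr
    · exact norm_powSum_le_card _ _
    · refine (Finset.prod_le_prod (fun _ _ => norm_nonneg _) fun j _ => h2 _ (mul_ne_zero
        (Finset.ne_of_mem_erase hb) (ha _ (Fin.succAbove_ne i j)))).trans ?_
      simp
  have h4 : ‖∑ b ∈ (Finset.univ : Finset (ZMod q)).erase 0, ∏ j, powSum k (b * (a j : ZMod q))‖ ≤
      q * (q * (√2 * k * √q) ^ n) := by
    refine (norm_sum_le_of_le _ h3).trans ?_
    rw [Finset.sum_const, nsmul_eq_mul]
    gcongr
    refine (Finset.card_erase_le).trans ?_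
    rw [Finset.card_univ, ZMod.card]
  have h5 : ∑ b ∈ (Finset.univ : Finset (ZMod q)).erase 0, ∏ j, powSum k (b * (a j : ZMod q)) =
      (((q : ℝ) * ((N : ℝ) - q ^ n) : ℝ) : ℂ) := by
    rw [← sub_eq_iff_eq_add'] at h1
    rw [← h1]
    push_cast
    ring
  rw [h5, Complex.norm_real, Real.norm_eq_abs, abs_mul, abs_of_pos hq0] at h4
  refine (le_of_mul_le_mul_left h4 hq0).trans (le_of_eq ?_)
  ring

end PowerSums

/-! ### Local densities at the primes dividing at most one coefficient -/

lemma intCast_zmod_pow_one_ne_zero_iff (p : ℕ) (n : ℤ) : (n : ZMod (p ^ 1)) ≠ 0 ↔ ¬ (p : ℤ) ∣ n := by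
  rw [Ne, ZMod.intCast_zmod_eq_zero_iff_dvd, pow_one]

section Prime

variable {p : ℕ} [hp : Fact p.Prime]

lemma abs_unitZeroCount_sub_le {k : ℕ} (hk : k ≠ 0) {n : ℕ} {a : Fin (n + 1) → ℤ}
    {i : Fin (n + 1)} {J : Finset (Fin (n + 1))} (hJ : ∀ j, j ≠ i → j ∈ J)
    (ha : ∀ j, j ≠ i → ¬ (p : ℤ) ∣ a j) :
    |(unitZeroCount k a p 1 J : ℝ) - p ^ n| ≤ (√2 * k) ^ n * (p * √p ^ n) + p := by
  classical
  have : Fact (p ^ 1).Prime := ⟨by simpa using hp.out⟩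
  have h1 := abs_card_zeros_sub_le (q := p ^ 1) hk (a := a) (i := i)
    fun j hj => (intCast_zmod_pow_one_ne_zero_iff p _).2 (ha j hj)
  set N := (Finset.univ.filter fun x : Fin (n + 1) → ZMod (p ^ 1) => diagForm k a x = 0).card
  have h2 : unitZeroCount k a p 1 J ≤ N := Finset.card_le_card fun x hx => by
    simp only [Finset.mem_filter] at hx ⊢
    exact ⟨hx.1, hx.2.1⟩
  -- a zero without unit coordinates in `J` vanishes outside the coordinate `i`
  have h3 : N ≤ unitZeroCount k a p 1 J + p := by
    have hsub : (Finset.univ.filter fun x : Fin (n + 1) → ZMod (p ^ 1) => diagForm k a x = 0) ⊆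
        (Finset.univ.filter fun x : Fin (n + 1) → ZMod (p ^ 1) =>
          diagForm k a x = 0 ∧ ∃ j ∈ J, IsUnit (x j)) ∪
        Finset.univ.image fun t : ZMod (p ^ 1) => Pi.single i t := by
      intro x hx
      simp only [Finset.mem_union, Finset.mem_filter, Finset.mem_univ, true_and,
        Finset.mem_image] at hx ⊢
      by_cases hex : ∃ j ∈ J, IsUnit (x j)
      · exact Or.inl ⟨hx, hex⟩
      · refine Or.inr ⟨x i, funext fun j => ?_⟩
        by_cases hj : j = i
        · subst hj; simp
        · push Not at hex
          have := hex j (hJ j hj)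
          rw [isUnit_iff_ne_zero, not_not] at this
          rw [this, Pi.single_eq_of_ne hj]
    refine (Finset.card_le_card hsub).trans ((Finset.card_union_le _ _).trans ?_)
    refine Nat.add_le_add_left (Finset.card_image_le.trans ?_) _
    simp [ZMod.card]
  have h2' : (unitZeroCount k a p 1 J : ℝ) ≤ N := by exact_mod_cast h2
  have h3' : (N : ℝ) ≤ unitZeroCount k a p 1 J + p := by exact_mod_cast h3
  have hp0 : (0 : ℝ) ≤ p := Nat.cast_nonneg p
  simp only [pow_one] at h1
  rw [abs_le] at h1 ⊢
  constructor <;> linarith [h1.1, h1.2]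

/-- A constant `C` for which `|χ_p - 1| ≤ C p ^ (-3/2)` at the primes `p > k` dividing no
coefficient. -/
noncomputable def densityConst (k s : ℕ) : ℝ := 2 * ((√2 * k) ^ (s - 1) + 2)

lemma densityConst_pos (k s : ℕ) : 0 < densityConst k s := by
  unfold densityConst
  positivity

lemma abs_unitDensity_sub_one_le {k : ℕ} (hk : k ≠ 0) {s : ℕ} (hs : 6 ≤ s) {a : Fin s → ℤ}
    {i : Fin s} {J : Finset (Fin s)} (hJ : ∀ j, j ≠ i → j ∈ J)
    (ha : ∀ j, j ≠ i → ¬ (p : ℤ) ∣ a j) :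
    |unitDensity k a p 1 J - 1| ≤ ((√2 * k) ^ (s - 1) + 1) * (p : ℝ) ^ (-(3 / 2) : ℝ) := by
  obtain ⟨n, rfl⟩ : ∃ n, s = n + 1 := ⟨s - 1, by omega⟩
  have h1 := abs_unitZeroCount_sub_le hk (p := p) hJ ha
  have hp1 : (1 : ℝ) ≤ p := by exact_mod_cast hp.out.one_le
  have hp0 : (0 : ℝ) < p := by linarith
  have e1 : unitDensity k a p 1 J - 1 =
      ((p : ℝ) ^ n)⁻¹ * ((unitZeroCount k a p 1 J : ℝ) - p ^ n) := by
    rw [unitDensity, mul_sub ((p : ℝ) ^ n)⁻¹, inv_mul_cancel₀ (by positivity)]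
    congr 2
    rw [← zpow_natCast, ← zpow_neg]
    congr 1
    push_cast
    ring
  rw [e1, abs_mul, abs_of_pos (by positivity), Nat.add_sub_cancel, add_mul, one_mul]
  have e2 : ((p : ℝ) ^ n)⁻¹ * (p * √p ^ n) ≤ (p : ℝ) ^ (-(3 / 2) : ℝ) := by
    rw [Real.sqrt_eq_rpow, ← Real.rpow_natCast, ← Real.rpow_neg hp0.le, ← Real.rpow_natCast,
      ← Real.rpow_mul hp0.le, ← Real.rpow_one_add' hp0.le (by positivity), ← Real.rpow_add hp0]
    refine Real.rpow_le_rpow_of_exponent_le hp1 ?_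
    have : (5 : ℝ) ≤ n := by exact_mod_cast (by omega : 5 ≤ n)
    linarith
  have e3 : ((p : ℝ) ^ n)⁻¹ * p ≤ (p : ℝ) ^ (-(3 / 2) : ℝ) := by
    refine le_trans ?_ e2
    gcongr
    exact le_mul_of_one_le_right hp0.le (one_le_pow₀ (Real.one_le_sqrt.2 hp1))
  calc ((p : ℝ) ^ n)⁻¹ * |(unitZeroCount k a p 1 J : ℝ) - p ^ n|
      ≤ ((p : ℝ) ^ n)⁻¹ * ((√2 * k) ^ n * (p * √p ^ n) + p) := by gcongr
    _ = (√2 * k) ^ n * (((p : ℝ) ^ n)⁻¹ * (p * √p ^ n)) + ((p : ℝ) ^ n)⁻¹ * p := by ring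
    _ ≤ _ := by gcongr

lemma not_dvd_natCast_mul {k : ℕ} (hk : k ≠ 0) (hkp : k < p) {b : ℤ} (hb : ¬ (p : ℤ) ∣ b) :
    ¬ (p : ℤ) ^ (0 + 1) ∣ k * b := by
  rw [zero_add, pow_one, (Nat.prime_iff_prime_int.1 hp.out).dvd_mul]
  rintro (h | h)
  · have h2 : p ∣ k := by exact_mod_cast h
    exact absurd (Nat.le_of_dvd (Nat.pos_of_ne_zero hk) h2) (by omega)
  · exact hb h

/-- Only zeros with a unit among the coordinates `j ≠ i` are counted here: these lift from the
modulus `p` to all its powers, even if `p ∣ a_i`. -/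
lemma one_sub_le_localDensity {k s : ℕ} (hk : k ≠ 0) (hks : k < s) (hs : 6 ≤ s) (hkp : k < p)
    {a : Fin s → ℤ} (h0 : ∀ j, a j ≠ 0) {i : Fin s} (ha : ∀ j, j ≠ i → ¬ (p : ℤ) ∣ a j) :
    1 - densityConst k s * (p : ℝ) ^ (-(3 / 2) : ℝ) ≤ localDensity k a p := by
  have h1 := unitDensity_le_localDensity (p := p) hk hks h0 (v := 0) (J := Finset.univ.erase i)
    fun j hj => not_dvd_natCast_mul hk hkp (ha j (Finset.ne_of_mem_erase hj))
  have h2 := (abs_le.1 (abs_unitDensity_sub_one_le (p := p) hk hs (a := a) (i := i)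
    (J := Finset.univ.erase i) (by simp) ha)).1
  have h3 : ((√2 * k) ^ (s - 1) + 1) * (p : ℝ) ^ (-(3 / 2) : ℝ) ≤
      densityConst k s * (p : ℝ) ^ (-(3 / 2) : ℝ) := by
    gcongr
    unfold densityConst
    have : (0 : ℝ) ≤ (√2 * k) ^ (s - 1) := by positivity
    linarith
  rw [Nat.mul_zero, Nat.zero_add] at h1
  linarith

lemma abs_localDensity_sub_one_le {k s : ℕ} (hk : k ≠ 0) (hks : k + 3 ≤ s) (hs : 6 ≤ s)
    (hkp : k < p) {a : Fin s → ℤ} (ha : ∀ j, ¬ (p : ℤ) ∣ a j) :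
    |localDensity k a p - 1| ≤ densityConst k s * (p : ℝ) ^ (-(3 / 2) : ℝ) := by
  have h1 := abs_unitDensity_sub_one_le (p := p) hk hs (a := a) (i := ⟨0, by omega⟩)
    (J := Finset.univ) (by simp) fun j _ => ha j
  rw [localDensity_eq hk (by omega) (v := 0) fun j => not_dvd_natCast_mul hk hkp (ha j),
    Nat.mul_zero, Nat.zero_add]
  set P := unitDensity k a p 1 Finset.univ
  set ρ := (p : ℝ) ^ ((k : ℤ) - s)
  set d := (p : ℝ) ^ (-(3 / 2) : ℝ)
  have hp2 : (2 : ℝ) ≤ p := by exact_mod_cast hp.out.two_le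
  have hρ0 : 0 ≤ ρ := by positivity
  have hρ : ρ ≤ d := by
    simp only [ρ, d]
    rw [← Real.rpow_intCast]
    refine Real.rpow_le_rpow_of_exponent_le (by linarith) ?_
    have : (k : ℝ) + 3 ≤ s := by exact_mod_cast hks
    push_cast
    linarith
  have hρ2 : ρ ≤ 1 / 2 := by
    calc ρ ≤ (p : ℝ) ^ (-1 : ℤ) := zpow_le_zpow_right₀ (by linarith) (by omega)
      _ ≤ 1 / 2 := by
        rw [zpow_neg_one, ← one_div]
        gcongr
  have e : P / (1 - ρ) - 1 = (P - 1 + ρ) / (1 - ρ) := by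
    have : 1 - ρ ≠ 0 := by linarith
    field_simp
    ring
  rw [e, abs_div, abs_of_pos (show 0 < 1 - ρ by linarith), div_le_iff₀ (by linarith)]
  have h2 : |P - 1 + ρ| ≤ ((√2 * k) ^ (s - 1) + 1) * d + d :=
    (abs_add_le _ _).trans (add_le_add h1 (by rwa [abs_of_nonneg hρ0]))
  have hd : 0 ≤ d := by positivity
  calc |P - 1 + ρ| ≤ ((√2 * k) ^ (s - 1) + 1) * d + d := h2
    _ = densityConst k s * d * (1 / 2) := by unfold densityConst; ring
    _ ≤ densityConst k s * d * (1 - ρ) := by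
      have := densityConst_pos k s
      gcongr
      linarith

end Prime

lemma summable_primes_rpow :
    Summable fun p : Nat.Primes => ((p : ℕ) : ℝ) ^ (-(3 / 2) : ℝ) :=
  Nat.Primes.summable_rpow.2 (by norm_num)

lemma summable_abs_localDensity_sub_one {k s : ℕ} (hk : k ≠ 0) (hks : k + 3 ≤ s) (hs : 6 ≤ s)
    {a : Fin s → ℤ} (ha : ∀ j, a j ≠ 0) :
    Summable fun p : Nat.Primes => |localDensity k a (p : ℕ) - 1| := by
  refine Summable.of_norm_bounded_eventually (summable_primes_rpow.mul_left (densityConst k s)) ?_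
  have hfin : {p : Nat.Primes | (p : ℕ) ≤ k + ∑ j, (a j).natAbs}.Finite :=
    (Set.finite_Iic (k + ∑ j, (a j).natAbs)).preimage
      (Subtype.val_injective.injOn (s := (fun p : Nat.Primes => (p : ℕ)) ⁻¹' _))
  filter_upwards [hfin.compl_mem_cofinite] with p hp
  simp only [Set.mem_compl_iff, Set.mem_ofPred_eq, not_le] at hp
  have : Fact (p : ℕ).Prime := ⟨p.2⟩
  rw [Real.norm_eq_abs, abs_abs]
  refine abs_localDensity_sub_one_le hk hks hs (by omega) fun j hj => ?_
  have h1 := Int.natAbs_dvd_natAbs.2 hj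
  rw [Int.natAbs_natCast] at h1
  have h2 := Nat.le_of_dvd (Int.natAbs_pos.2 (ha j)) h1
  have h3 := Finset.single_le_sum (f := fun j => (a j).natAbs) (fun _ _ => Nat.zero_le _)
    (Finset.mem_univ j)
  omega

/-! ### A lower bound for the singular product -/

/-- The largest divisor of `m` all of whose prime factors divide `n`, for `m, n ≠ 0`. -/
def sharedPart (m n : ℕ) : ℕ := ∏ p ∈ n.primeFactors, p ^ m.factorization p

/-- The product of the parts of the `a_i` that are composed of primes dividing `Q a_j`, over all
pairs `i ≠ j`. -/
def pairProduct (Q : ℕ) {s : ℕ} (a : Fin s → ℤ) : ℕ :=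
  ∏ i, ∏ j ∈ Finset.univ.erase i, sharedPart (a i).natAbs (Q * (a j).natAbs)

/-- The largest exponent with which `p` divides one of the coefficients. -/
def maxExponent {s : ℕ} (a : Fin s → ℤ) (p : ℕ) : ℕ :=
  Finset.univ.sup fun j => (a j).natAbs.factorization p

lemma one_sub_sum_le_prod_one_sub {ι : Type*} (S : Finset ι) (f : ι → ℝ) (h0 : ∀ i ∈ S, 0 ≤ f i)
    (h1 : ∀ i ∈ S, f i ≤ 1) : 1 - ∑ i ∈ S, f i ≤ ∏ i ∈ S, (1 - f i) := by
  classical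
  induction S using Finset.induction_on with
  | empty => simp
  | insert i S hi ih =>
    rw [Finset.sum_insert hi, Finset.prod_insert hi]
    have h2 := ih (fun j hj => h0 j (Finset.mem_insert_of_mem hj))
      fun j hj => h1 j (Finset.mem_insert_of_mem hj)
    have h3 : ∏ j ∈ S, (1 - f j) ≤ 1 := Finset.prod_le_one
      (fun j hj => sub_nonneg.2 (h1 j (Finset.mem_insert_of_mem hj)))
      fun j hj => sub_le_self _ (h0 j (Finset.mem_insert_of_mem hj))
    have h4 := h0 i (Finset.mem_insert_self _ _)
    nlinarith

lemma not_pow_dvd_of_maxExponent {k s p : ℕ} (hp : p.Prime) (hk : k ≠ 0) {a : Fin s → ℤ}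
    (ha : ∀ j, a j ≠ 0) (j : Fin s) :
    ¬ (p : ℤ) ^ (k.factorization p + maxExponent a p + 1) ∣ k * a j := by
  intro h
  have h1 := Int.natAbs_dvd_natAbs.2 h
  rw [Int.natAbs_pow, Int.natAbs_mul, Int.natAbs_natCast, Int.natAbs_natCast,
    hp.pow_dvd_iff_le_factorization (mul_ne_zero hk (Int.natAbs_ne_zero.2 (ha j))),
    Nat.factorization_mul hk (Int.natAbs_ne_zero.2 (ha j)), Finsupp.add_apply] at h1
  have h2 : (a j).natAbs.factorization p ≤ maxExponent a p :=
    Finset.le_sup (f := fun j => (a j).natAbs.factorization p) (Finset.mem_univ j)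
  omega

lemma prod_ite_dvd_le (S : Finset Nat.Primes) (f : ℕ → ℕ) {n : ℕ} (hn : n ≠ 0) :
    ∏ p ∈ S, (if (p : ℕ) ∣ n then (p : ℕ) ^ f p else 1) ≤ ∏ q ∈ n.primeFactors, q ^ f q := by
  have h1 := Finset.prod_image (s := S.filter fun p : Nat.Primes => (p : ℕ) ∣ n)
    (g := fun p : Nat.Primes => (p : ℕ)) (f := fun q => q ^ f q)
    fun p _ q _ h => Nat.Primes.coe_nat_injective h
  rw [← Finset.prod_filter, ← h1]
  refine Nat.le_of_dvd (Finset.prod_pos fun q hq => pow_pos (Nat.prime_of_mem_primeFactors hq).pos _)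
    (Finset.prod_dvd_prod_of_subset _ _ _ fun q hq => ?_)
  obtain ⟨p, hp, rfl⟩ := Finset.mem_image.1 hq
  exact Nat.mem_primeFactors.2 ⟨p.2, (Finset.mem_filter.1 hp).2, hn⟩

/-- If every coefficient `a_i` has a partner `a_j` with `p ∣ Q a_j`, then the highest power of `p`
dividing a coefficient is visible in a shared part. -/
lemma prod_pow_maxExponent_le {Q s : ℕ} (hQ : Q ≠ 0) (hs : s ≠ 0) {a : Fin s → ℤ}
    (ha : ∀ j, a j ≠ 0) (S : Finset Nat.Primes)
    (hS : ∀ p ∈ S, ∀ i, ∃ j, j ≠ i ∧ (p : ℕ) ∣ Q * (a j).natAbs) :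
    ∏ p ∈ S, (p : ℕ) ^ maxExponent a p ≤ pairProduct Q a := by
  have h1 : ∀ p ∈ S, (p : ℕ) ^ maxExponent a p ≤ ∏ i, ∏ j ∈ Finset.univ.erase i,
      if (p : ℕ) ∣ Q * (a j).natAbs then (p : ℕ) ^ (a i).natAbs.factorization p else 1 := by
    intro p hp
    have : NeZero s := ⟨hs⟩
    obtain ⟨i, -, hi⟩ := Finset.exists_mem_eq_sup Finset.univ Finset.univ_nonempty
      fun j => (a j).natAbs.factorization p
    obtain ⟨j, hji, hj⟩ := hS p hp i
    refine Nat.le_of_dvd ?_ ?_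
    · refine Finset.prod_pos fun i _ => Finset.prod_pos fun j _ => ?_
      split_ifs
      · exact pow_pos p.2.pos _
      · exact one_pos
    · have h2 : (if (p : ℕ) ∣ Q * (a j).natAbs then (p : ℕ) ^ (a i).natAbs.factorization p else 1) =
          (p : ℕ) ^ maxExponent a p := by rw [if_pos hj, maxExponent, hi]
      rw [← h2]
      exact (Finset.dvd_prod_of_mem (fun j => if (p : ℕ) ∣ Q * (a j).natAbs then
        (p : ℕ) ^ (a i).natAbs.factorization p else 1)
        (Finset.mem_erase.2 ⟨hji, Finset.mem_univ j⟩)).trans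
        (Finset.dvd_prod_of_mem (fun i => ∏ j ∈ Finset.univ.erase i,
          if (p : ℕ) ∣ Q * (a j).natAbs then (p : ℕ) ^ (a i).natAbs.factorization p else 1)
          (Finset.mem_univ i))
  refine (Finset.prod_le_prod' h1).trans ?_
  rw [Finset.prod_comm]
  refine Finset.prod_le_prod' fun i _ => ?_
  rw [Finset.prod_comm]
  exact Finset.prod_le_prod' fun j _ => prod_ite_dvd_le S _
    (mul_ne_zero hQ (Int.natAbs_ne_zero.2 (ha j)))

lemma localDensity_pos_of_singularProduct_pos {k s : ℕ} (hk : k ≠ 0) (hks : k < s)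
    {a : Fin s → ℤ} (ha : ∀ j, a j ≠ 0) (hpos : 0 < singularProduct k a) (p : Nat.Primes) :
    0 < localDensity k a (p : ℕ) := by
  have : Fact (p : ℕ).Prime := ⟨p.2⟩
  refine lt_of_le_of_ne (localDensity_nonneg hk hks ha) fun h => hpos.ne' ?_
  exact tprod_of_exists_eq_zero ⟨p, h.symm⟩

/-- The singular product, when positive, is bounded below in terms of `pairProduct`. For a fixed `Q`
divisible by all small primes, a prime `p ∤ Q` dividing at most one coefficient contributes a factor
`1 - O(p ^ (-3/2))`; at the other primes positivity forces a zero with a unit coordinate to a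
modulus that is bounded in terms of the maximal exponent of `p` in the coefficients. -/
lemma exists_le_singularProduct {k s : ℕ} (hk : k ≠ 0) (hks : k + 3 ≤ s) (hs : 6 ≤ s) :
    ∃ Q : ℕ, Q ≠ 0 ∧ ∃ c : ℝ, 0 < c ∧ ∀ a : Fin s → ℤ, (∀ j, a j ≠ 0) → 0 < singularProduct k a →
      c * (((pairProduct Q a : ℝ) ^ 3) ^ (s - 1))⁻¹ ≤ singularProduct k a := by
  classical
  have hsum := summable_primes_rpow.mul_left (densityConst k s)
  set x : Nat.Primes → ℝ := fun p => densityConst k s * ((p : ℕ) : ℝ) ^ (-(3 / 2) : ℝ)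
  have hx0 : ∀ p, 0 ≤ x p := fun p => mul_nonneg (densityConst_pos k s).le (by positivity)
  obtain ⟨T, hT⟩ := summable_iff_vanishing_norm.1 hsum (1 / 2) (by norm_num)
  set Q := k.factorial * ∏ p ∈ T, (p : ℕ)
  have hQ : Q ≠ 0 := mul_ne_zero (Nat.factorial_ne_zero k)
    (Finset.prod_ne_zero_iff.2 fun p _ => p.2.ne_zero)
  set B := ∏ p ∈ Q.primeFactors, p ^ (2 * k.factorization p + 1)
  have hB : 0 < B := Finset.prod_pos fun p hp => pow_pos (Nat.prime_of_mem_primeFactors hp).pos _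
  refine ⟨Q, hQ, 1 / 2 * ((B : ℝ) ^ (s - 1))⁻¹, by positivity, fun a ha hpos => ?_⟩
  have hmult : Multipliable fun p : Nat.Primes => localDensity k a (p : ℕ) := by
    have := Real.multipliable_one_add_of_summable
      (Summable.of_abs (summable_abs_localDensity_sub_one hk hks hs ha))
    simpa using this
  refine ge_of_tendsto' hmult.hasProd fun S => ?_
  let good : Nat.Primes → Prop := fun p => ¬ (p : ℕ) ∣ Q ∧
    ∃ i, ∀ j, j ≠ i → ¬ ((p : ℕ) : ℤ) ∣ a j
  have hkp : ∀ p : Nat.Primes, ¬ (p : ℕ) ∣ Q → k < p := fun p hp => by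
    by_contra hle
    exact hp ((Nat.dvd_factorial p.2.pos (not_lt.1 hle)).trans (dvd_mul_right _ _))
  rw [← Finset.prod_filter_mul_prod_filter_not S good]
  have hgood : (1 / 2 : ℝ) ≤ ∏ p ∈ S with good p, localDensity k a (p : ℕ) := by
    have hdisj : Disjoint (S.filter good) T := by
      refine Finset.disjoint_left.2 fun p hp hpT => (Finset.mem_filter.1 hp).2.1 ?_
      exact (Finset.dvd_prod_of_mem (fun p : Nat.Primes => (p : ℕ)) hpT).trans (dvd_mul_left _ _)
    have h1 := hT _ hdisj
    rw [Real.norm_of_nonneg (Finset.sum_nonneg fun p _ => hx0 p)] at h1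
    have h2 : ∀ p ∈ S.filter good, x p ≤ 1 := fun p hp =>
      (Finset.single_le_sum (fun p _ => hx0 p) hp).trans (h1.le.trans (by norm_num))
    calc (1 / 2 : ℝ) ≤ 1 - ∑ p ∈ S with good p, x p := by linarith
      _ ≤ ∏ p ∈ S with good p, (1 - x p) :=
        one_sub_sum_le_prod_one_sub _ _ (fun p _ => hx0 p) h2
      _ ≤ _ := Finset.prod_le_prod (fun p hp => sub_nonneg.2 (h2 p hp)) fun p hp => by
        have : Fact (p : ℕ).Prime := ⟨p.2⟩
        obtain ⟨hpQ, i, hi⟩ := (Finset.mem_filter.1 hp).2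
        exact one_sub_le_localDensity hk (by omega) hs (hkp p hpQ) ha hi
  set U := S.filter fun p => ¬ good p
  have hU : ∀ p ∈ U, ∀ i, ∃ j, j ≠ i ∧ (p : ℕ) ∣ Q * (a j).natAbs := by
    intro p hp i
    have hng := (Finset.mem_filter.1 hp).2
    by_cases hpQ : (p : ℕ) ∣ Q
    · have : Nontrivial (Fin s) := Fin.nontrivial_iff_two_le.2 (by omega)
      obtain ⟨j, hj⟩ := exists_ne i
      exact ⟨j, hj, hpQ.mul_right _⟩
    · simp only [good, not_and, not_exists, not_forall, not_not] at hng
      obtain ⟨j, hj, hd⟩ := hng hpQ i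
      exact ⟨j, hj, (Int.natCast_dvd.1 hd).mul_left _⟩
  have hE := prod_pow_maxExponent_le hQ (by omega) ha U hU
  have hbad : ∏ p ∈ U, (p : ℕ) ^ (2 * (k.factorization p + maxExponent a p) + 1) ≤
      B * pairProduct Q a ^ 3 := by
    have h1 : ∀ p ∈ U, (p : ℕ) ^ (2 * (k.factorization p + maxExponent a p) + 1) ≤
        (if (p : ℕ) ∣ Q then (p : ℕ) ^ (2 * k.factorization p + 1) else 1) *
          ((p : ℕ) ^ maxExponent a p) ^ 3 := by
      intro p hp
      split_ifs with hpQ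
      · rw [← pow_mul, ← pow_add]
        exact Nat.pow_le_pow_right p.2.pos (by omega)
      · rw [← pow_mul, one_mul, Nat.factorization_eq_zero_of_lt (hkp p hpQ)]
        refine Nat.pow_le_pow_right p.2.pos ?_
        -- `p` divides some coefficient, so the maximal exponent is positive
        obtain ⟨j, -, hj⟩ := hU p hp ⟨0, by omega⟩
        have h2 := (p.2.dvd_mul.1 hj).resolve_left hpQ
        have h3 := (p.2.dvd_iff_one_le_factorization (Int.natAbs_ne_zero.2 (ha j))).1 h2
        have h4 : (a j).natAbs.factorization p ≤ maxExponent a p :=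
          Finset.le_sup (f := fun j => (a j).natAbs.factorization p) (Finset.mem_univ j)
        omega
    refine (Finset.prod_le_prod' h1).trans ?_
    rw [Finset.prod_mul_distrib, Finset.prod_pow]
    exact Nat.mul_le_mul (prod_ite_dvd_le U (fun p => 2 * k.factorization p + 1) hQ)
      (Nat.pow_le_pow_left hE 3)
  have hbad' : ((((B : ℝ) * (pairProduct Q a : ℝ) ^ 3)) ^ (s - 1))⁻¹ ≤
      ∏ p ∈ U, localDensity k a (p : ℕ) := by
    have h2 : ∏ p ∈ U, ((((p : ℕ) : ℝ) ^ (2 * (k.factorization p + maxExponent a p) + 1)) ^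
        (s - 1))⁻¹ ≤ ∏ p ∈ U, localDensity k a (p : ℕ) := by
      refine Finset.prod_le_prod (fun p _ => by positivity) fun p _ => ?_
      have : Fact (p : ℕ).Prime := ⟨p.2⟩
      exact le_localDensity_of_pos hk (by omega) ha (not_pow_dvd_of_maxExponent p.2 hk ha)
        (localDensity_pos_of_singularProduct_pos hk (by omega) ha hpos p)
    refine le_trans ?_ h2
    rw [Finset.prod_inv_distrib, Finset.prod_pow]
    have h3 : ∏ p ∈ U, ((p : ℕ) : ℝ) ^ (2 * (k.factorization p + maxExponent a p) + 1) ≤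
        B * (pairProduct Q a : ℝ) ^ 3 := by exact_mod_cast hbad
    have h4 : 0 < ∏ p ∈ U, ((p : ℕ) : ℝ) ^ (2 * (k.factorization p + maxExponent a p) + 1) :=
      Finset.prod_pos fun p _ => pow_pos (by exact_mod_cast p.2.pos) _
    gcongr
  calc _ = (1 / 2 : ℝ) * (((B : ℝ) * (pairProduct Q a : ℝ) ^ 3) ^ (s - 1))⁻¹ := by
        rw [mul_pow, mul_inv, mul_assoc]
    _ ≤ _ := mul_le_mul hgood hbad' (by positivity) (le_trans (by norm_num) hgood)

/-! ### Counting coefficient vectors with a large shared part -/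

lemma one_le_sharedPart (m n : ℕ) : 1 ≤ sharedPart m n :=
  Finset.prod_pos fun _ hp => pow_pos (Nat.prime_of_mem_primeFactors hp).pos _

lemma sharedPart_dvd {m : ℕ} (hm : m ≠ 0) (n : ℕ) : sharedPart m n ∣ m := by
  conv_rhs => rw [← Nat.prod_factorization_pow_eq_self hm]
  rw [sharedPart, Finsupp.prod, Nat.support_factorization, ← Finset.prod_filter_mul_prod_filter_not
    n.primeFactors (· ∈ m.primeFactors)]
  have h1 : ∏ p ∈ n.primeFactors with p ∉ m.primeFactors, p ^ m.factorization p = 1 :=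
    Finset.prod_eq_one fun p hp => by
      have := (Finset.mem_filter.1 hp).2
      rw [← Nat.support_factorization, Finsupp.notMem_support_iff] at this
      rw [this, pow_zero]
  rw [h1, mul_one]
  exact Finset.prod_dvd_prod_of_subset _ _ _ fun p hp => (Finset.mem_filter.1 hp).2

lemma sharedPart_mem_factoredNumbers (m n : ℕ) :
    sharedPart m n ∈ Nat.factoredNumbers n.primeFactors := by
  refine Nat.mem_factoredNumbers'.2 fun q hq hd => ?_
  obtain ⟨p, hp, hqp⟩ := (Prime.dvd_finsetProd_iff hq.prime _).1 hd
  have := (Nat.prime_dvd_prime_iff_eq hq (Nat.prime_of_mem_primeFactors hp)).1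
    (hq.dvd_of_dvd_pow hqp)
  exact this ▸ hp

/-- The completely multiplicative function `m ↦ m ^ (-1/2)`, with value `0` at `0`. -/
noncomputable def invSqrtHom : ℕ →* ℝ where
  toFun m := (√(m : ℝ))⁻¹
  map_one' := by simp
  map_mul' m n := by simp [Real.sqrt_mul (Nat.cast_nonneg m), mul_comm]

lemma invSqrtHom_nonneg (m : ℕ) : 0 ≤ invSqrtHom m :=
  inv_nonneg.2 (Real.sqrt_nonneg _)

lemma invSqrtHom_prime_le {p : ℕ} (hp : p.Prime) : invSqrtHom p ≤ 3 / 4 := by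
  have h1 : (4 / 3 : ℝ) ≤ √p := by
    refine Real.le_sqrt_of_sq_le ?_
    have : (2 : ℝ) ≤ p := by exact_mod_cast hp.two_le
    linarith
  calc invSqrtHom p ≤ (4 / 3 : ℝ)⁻¹ := inv_anti₀ (by norm_num) h1
    _ = 3 / 4 := by norm_num

/-- The sum of `d ^ (-1/2)` over integers composed of the primes dividing `n`, by its Euler
product. -/
lemma sum_invSqrtHom_le (n : ℕ) (T : Finset ℕ)
    (hT : ∀ d ∈ T, d ∈ Nat.factoredNumbers n.primeFactors) :
    ∑ d ∈ T, invSqrtHom d ≤ 4 ^ n.primeFactors.card := by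
  have h0 : ∀ {p : ℕ}, p.Prime → ‖invSqrtHom p‖ < 1 := fun hp => by
    rw [Real.norm_of_nonneg (invSqrtHom_nonneg _)]
    exact (invSqrtHom_prime_le hp).trans_lt (by norm_num)
  have h1 := (EulerProduct.summable_and_hasSum_factoredNumbers_prod_filter_prime_geometric h0
    n.primeFactors).2
  have h2 : ∑ d ∈ T, invSqrtHom d ≤ ∏ p ∈ n.primeFactors with p.Prime, (1 - invSqrtHom p)⁻¹ := by
    rw [← Finset.sum_attach]
    have h3 := Finset.sum_map T.attach
      ⟨fun d => (⟨d.1, hT d.1 d.2⟩ : Nat.factoredNumbers n.primeFactors), fun d e h =>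
        Subtype.ext (Subtype.mk.inj h)⟩ (fun d => invSqrtHom (d : ℕ))
    exact h3.symm.trans_le (sum_le_hasSum _ (fun d _ => invSqrtHom_nonneg _) h1)
  refine h2.trans ?_
  refine (Finset.prod_le_prod (g := fun _ => (4 : ℝ)) (fun p hp => ?_) fun p hp => ?_).trans ?_
  · have := invSqrtHom_prime_le (Finset.mem_filter.1 hp).2
    exact inv_nonneg.2 (by linarith)
  · have := invSqrtHom_prime_le (Finset.mem_filter.1 hp).2
    rw [inv_le_comm₀ (by linarith) (by norm_num)]
    linarith
  · rw [Finset.prod_const]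
    exact pow_le_pow_right₀ (by norm_num) (Finset.card_filter_le _ _)

/-- Rankin's trick: few integers up to `M` have a large part composed of the primes
dividing `n`. -/
lemma card_sharedPart_ge_le (n M : ℕ) {D : ℝ} (hD : 0 < D) :
    (((Finset.Icc 1 M).filter fun m => D ≤ sharedPart m n).card : ℝ) ≤
      M * (√D)⁻¹ * 4 ^ n.primeFactors.card := by
  set F := (Finset.Icc 1 M).filter fun m => D ≤ sharedPart m n
  set T := F.image fun m => sharedPart m n
  have h1 : ∀ d ∈ T, d ∈ Nat.factoredNumbers n.primeFactors ∧ D ≤ d ∧ 0 < d := by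
    intro d hd
    obtain ⟨m, hm, rfl⟩ := Finset.mem_image.1 hd
    exact ⟨sharedPart_mem_factoredNumbers m n, (Finset.mem_filter.1 hm).2, one_le_sharedPart m n⟩
  have h2 : ∀ d ∈ T, ((F.filter fun m => sharedPart m n = d).card : ℝ) ≤
      M * (√D)⁻¹ * invSqrtHom d := by
    intro d hd
    obtain ⟨-, hDd, hd0⟩ := h1 d hd
    have h3 : (F.filter fun m => sharedPart m n = d).card ≤ M / d := by
      rw [← Nat.Ioc_filter_dvd_card_eq_div]
      refine Finset.card_le_card fun m hm => ?_
      obtain ⟨hmF, rfl⟩ := Finset.mem_filter.1 hm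
      have hm1 := Finset.mem_Icc.1 (Finset.mem_filter.1 hmF).1
      exact Finset.mem_filter.2 ⟨Finset.mem_Ioc.2 ⟨by omega, hm1.2⟩, sharedPart_dvd (by omega) n⟩
    have hd0' : (0 : ℝ) < d := by exact_mod_cast hd0
    calc ((F.filter fun m => sharedPart m n = d).card : ℝ) ≤ ((M / d : ℕ) : ℝ) := by
          exact_mod_cast h3
      _ ≤ M / d := Nat.cast_div_le
      _ = M * ((√d)⁻¹ * (√d)⁻¹) := by
        rw [← mul_inv, Real.mul_self_sqrt hd0'.le, div_eq_mul_inv]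
      _ ≤ M * ((√D)⁻¹ * (√d)⁻¹) := by gcongr
      _ = M * (√D)⁻¹ * invSqrtHom d := by rw [mul_assoc]; rfl
  have h4 := Finset.card_eq_sum_card_image (fun m => sharedPart m n) F
  rw [h4]
  push_cast
  refine (Finset.sum_le_sum h2).trans ?_
  rw [← Finset.mul_sum]
  gcongr
  exact sum_invSqrtHom_le n T fun d hd => (h1 d hd).1

lemma exists_four_pow_card_primeFactors_le {ε : ℝ} (hε : 0 < ε) :
    ∃ K : ℝ, 0 < K ∧ ∀ n : ℕ, n ≠ 0 → (4 : ℝ) ^ n.primeFactors.card ≤ K * (n : ℝ) ^ ε := by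
  obtain ⟨N, hN⟩ := exists_nat_ge ((4 : ℝ) ^ (1 / ε))
  refine ⟨4 ^ N, by positivity, fun n hn => ?_⟩
  have hlarge : ∀ p : ℕ, N ≤ p → (4 : ℝ) ≤ (p : ℝ) ^ ε := by
    intro p hp
    have h1 : (4 : ℝ) ^ (1 / ε) ≤ p := hN.trans (by exact_mod_cast hp)
    calc (4 : ℝ) = ((4 : ℝ) ^ (1 / ε)) ^ ε := by
          rw [← Real.rpow_mul (by norm_num), one_div, inv_mul_cancel₀ hε.ne', Real.rpow_one]
      _ ≤ (p : ℝ) ^ ε := Real.rpow_le_rpow (by positivity) h1 hε.le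
  rw [← Finset.card_filter_add_card_filter_not (s := n.primeFactors) (fun p => p < N), pow_add]
  gcongr ?_ * ?_
  · refine pow_le_pow_right₀ (by norm_num) ?_
    refine (Finset.card_le_card (t := Finset.range N) fun p hp => ?_).trans (by simp)
    exact Finset.mem_range.2 (Finset.mem_filter.1 hp).2
  · calc (4 : ℝ) ^ (n.primeFactors.filter fun p => ¬ p < N).card
        = ∏ p ∈ n.primeFactors with ¬ p < N, (4 : ℝ) := by rw [Finset.prod_const]
      _ ≤ ∏ p ∈ n.primeFactors with ¬ p < N, (p : ℝ) ^ ε :=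
        Finset.prod_le_prod (fun _ _ => by norm_num) fun p hp =>
          hlarge p (not_lt.1 (Finset.mem_filter.1 hp).2)
      _ = (((∏ p ∈ n.primeFactors with ¬ p < N, p : ℕ) : ℝ)) ^ ε := by
        push_cast
        rw [Real.finsetProd_rpow _ _ fun p _ => Nat.cast_nonneg p]
      _ ≤ (n : ℝ) ^ ε := by
        refine Real.rpow_le_rpow (Nat.cast_nonneg _) ?_ hε.le
        have h1 : ∏ p ∈ n.primeFactors with ¬ p < N, p ∣ n :=
          (Finset.prod_dvd_prod_of_subset _ _ _ (Finset.filter_subset _ _)).trans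
            (Nat.prod_primeFactors_dvd n)
        exact_mod_cast Nat.le_of_dvd (Nat.pos_of_ne_zero hn) h1

/-- The non-zero integers of absolute value at most `N`. -/
noncomputable def nonzeroInterval (N : ℕ) : Finset ℤ := (Finset.Icc (-(N : ℤ)) N).erase 0

lemma mem_nonzeroInterval {N : ℕ} {z : ℤ} : z ∈ nonzeroInterval N ↔ z ≠ 0 ∧ z.natAbs ≤ N := by
  rw [nonzeroInterval, Finset.mem_erase, Finset.mem_Icc]
  omega

lemma card_nonzeroInterval (N : ℕ) : (nonzeroInterval N).card = 2 * N := by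
  rw [nonzeroInterval, Finset.card_erase_of_mem (by simp), Int.card_Icc]
  omega

/-- Vectors of non-zero integers bounded by `N` for which the part of `a_i` composed of primes
dividing `Q a_j` is at least `D`. -/
noncomputable def largeSharedPart (s N Q : ℕ) (D : ℝ) (i j : Fin s) : Finset (Fin s → ℤ) :=
  (Fintype.piFinset fun _ => nonzeroInterval N).filter fun a =>
    D ≤ sharedPart (a i).natAbs (Q * (a j).natAbs)

lemma card_nonzeroInterval_sharedPart_le (n N : ℕ) (D : ℝ) :
    ((nonzeroInterval N).filter fun z => D ≤ sharedPart z.natAbs n).card ≤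
      2 * ((Finset.Icc 1 N).filter fun m => D ≤ sharedPart m n).card := by
  refine (Finset.card_le_mul_card_image (f := Int.natAbs) _ 2 fun m _ => ?_).trans ?_
  · refine (Finset.card_le_card (t := {(m : ℤ), -(m : ℤ)}) fun z hz => ?_).trans Finset.card_le_two
    have := (Finset.mem_filter.1 hz).2
    rw [Finset.mem_insert, Finset.mem_singleton]
    omega
  · refine Nat.mul_le_mul_left 2 (Finset.card_le_card fun m hm => ?_)
    obtain ⟨z, hz, rfl⟩ := Finset.mem_image.1 hm
    obtain ⟨hz1, hz2⟩ := Finset.mem_filter.1 hz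
    have := mem_nonzeroInterval.1 hz1
    exact Finset.mem_filter.2 ⟨Finset.mem_Icc.2 ⟨by omega, this.2⟩, hz2⟩

lemma card_largeSharedPart_le {ε K : ℝ} (hε : 0 < ε)
    (hK : ∀ n : ℕ, n ≠ 0 → (4 : ℝ) ^ n.primeFactors.card ≤ K * (n : ℝ) ^ ε) {s Q : ℕ} (hQ : Q ≠ 0)
    (N : ℕ) {D : ℝ} (hD : 0 < D) {i j : Fin s} (hij : i ≠ j) :
    ((largeSharedPart s N Q D i j).card : ℝ) ≤
      (2 * N) ^ s * ((√D)⁻¹ * (K * ((Q * N : ℕ) : ℝ) ^ ε)) := by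
  obtain _ | n := s
  · exact i.elim0
  set R : ℝ := 2 * (N * (√D)⁻¹ * (K * ((Q * N : ℕ) : ℝ) ^ ε))
  have hK0 : 0 ≤ K := by
    have := hK 1 one_ne_zero
    simp at this
    linarith
  have hR : 0 ≤ R := by positivity
  obtain ⟨j, rfl⟩ := Fin.exists_succAbove_eq hij.symm
  have h1 : (largeSharedPart (n + 1) N Q D i (i.succAbove j)).card ≤
      ⌊R⌋₊ * ((largeSharedPart (n + 1) N Q D i (i.succAbove j)).image i.removeNth).card := by
    refine Finset.card_le_mul_card_image _ _ fun b hb => Nat.le_floor ?_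
    obtain ⟨a, ha, rfl⟩ := Finset.mem_image.1 hb
    have haj := mem_nonzeroInterval.1
      (Fintype.mem_piFinset.1 (Finset.mem_filter.1 ha).1 (i.succAbove j))
    set m := Q * (a (i.succAbove j)).natAbs
    have hm : m ≠ 0 := mul_ne_zero hQ (Int.natAbs_ne_zero.2 haj.1)
    have h2 : ((largeSharedPart (n + 1) N Q D i (i.succAbove j)).filter
        fun b => i.removeNth b = i.removeNth a).card ≤
        ((nonzeroInterval N).filter fun z => D ≤ sharedPart z.natAbs m).card := by
      refine Finset.card_le_card_of_injOn (fun b => b i) (fun b hb => ?_) fun b hb c hc hbc => ?_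
      · obtain ⟨hb1, hb2⟩ := Finset.mem_filter.1 (Finset.mem_coe.1 hb)
        obtain ⟨hb3, hb4⟩ := Finset.mem_filter.1 hb1
        have h3 : b (i.succAbove j) = a (i.succAbove j) := congrFun hb2 j
        rw [h3] at hb4
        exact Finset.mem_coe.2 (Finset.mem_filter.2 ⟨Fintype.mem_piFinset.1 hb3 i, hb4⟩)
      · have hb2 := (Finset.mem_filter.1 (Finset.mem_coe.1 hb)).2
        have hc2 := (Finset.mem_filter.1 (Finset.mem_coe.1 hc)).2
        rw [← Fin.insertNth_self_removeNth i b, ← Fin.insertNth_self_removeNth i c, hb2, hc2]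
        exact congrArg (fun t => i.insertNth t _) hbc
    have h3 : (((nonzeroInterval N).filter fun z => D ≤ sharedPart z.natAbs m).card : ℝ) ≤
        2 * ((Finset.Icc 1 N).filter fun z => D ≤ sharedPart z m).card := by
      exact_mod_cast card_nonzeroInterval_sharedPart_le m N D
    calc _ ≤ (((nonzeroInterval N).filter fun z => D ≤ sharedPart z.natAbs m).card : ℝ) := by
          exact_mod_cast h2
      _ ≤ 2 * (N * (√D)⁻¹ * 4 ^ m.primeFactors.card) :=
        h3.trans (by gcongr; exact card_sharedPart_ge_le m N hD)
      _ ≤ 2 * (N * (√D)⁻¹ * (K * (m : ℝ) ^ ε)) := by gcongr; exact hK m hm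
      _ ≤ R := by
        simp only [R]
        gcongr
        exact Nat.mul_le_mul_left Q haj.2
  have h2 : ((largeSharedPart (n + 1) N Q D i (i.succAbove j)).image i.removeNth).card ≤
      (2 * N) ^ n := by
    refine (Finset.card_le_card (t := Fintype.piFinset fun _ : Fin n => nonzeroInterval N)
      fun b hb => ?_).trans (by simp [card_nonzeroInterval])
    obtain ⟨a, ha, rfl⟩ := Finset.mem_image.1 hb
    exact Fintype.mem_piFinset.2 fun l =>
      Fintype.mem_piFinset.1 (Finset.mem_filter.1 ha).1 (i.succAbove l)
  calc ((largeSharedPart (n + 1) N Q D i (i.succAbove j)).card : ℝ)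
      ≤ ⌊R⌋₊ * (2 * N) ^ n := by exact_mod_cast h1.trans (Nat.mul_le_mul_left _ h2)
    _ ≤ R * (2 * N) ^ n := by gcongr; exact Nat.floor_le hR
    _ = _ := by simp only [R]; ring

/-- If the product of the shared parts is large, one of them is. -/
lemma exists_le_sharedPart {s Q : ℕ} {a : Fin s → ℤ} {D : ℝ}
    (h : D ^ ((s - 1) * s) < pairProduct Q a) :
    ∃ i j, i ≠ j ∧ D ≤ sharedPart (a i).natAbs (Q * (a j).natAbs) := by
  by_contra! hcon
  refine h.not_ge ?_
  unfold pairProduct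
  push_cast
  calc ∏ i, ∏ j ∈ Finset.univ.erase i, (sharedPart (a i).natAbs (Q * (a j).natAbs) : ℝ)
      ≤ ∏ i : Fin s, ∏ j ∈ Finset.univ.erase i, D := by
        refine Finset.prod_le_prod (fun i _ => by positivity) fun i _ =>
          Finset.prod_le_prod (fun j _ => by positivity) fun j hj =>
            (hcon i j (Finset.ne_of_mem_erase hj).symm).le
    _ = D ^ ((s - 1) * s) := by simp [pow_mul]

theorem theorem1p2 (k s : ℕ) (hk : 3 ≤ k) (hs : k + 3 ≤ s) :
    (∀ a : Fin s → ℤ, (∀ j, a j ≠ 0) →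
      (∀ p : Nat.Primes, Filter.Tendsto (fun h : ℕ => normalizedCount k a (p : ℕ) h)
        Filter.atTop (nhds (localDensity k a (p : ℕ)))) ∧
      Summable fun p : Nat.Primes => |localDensity k a (p : ℕ) - 1|) ∧
    ∀ η : ℝ, 0 < η → ∃ γ : ℝ, 0 < γ ∧ ∃ C : ℝ, ∀ A : ℝ, 1 ≤ A →
      (Set.ncard {a : Fin s → ℤ | (∀ j, a j ≠ 0) ∧ (∀ j, |(a j : ℝ)| ≤ A) ∧
        0 < singularProduct k a ∧ singularProduct k a < A ^ (-η)} : ℝ) ≤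
      C * A ^ ((s : ℝ) - γ) := by
  have hk0 : k ≠ 0 := by omega
  refine ⟨fun a ha => ⟨fun p => ?_, summable_abs_localDensity_sub_one hk0 hs (by omega) ha⟩,
    fun η hη => ?_⟩
  · have : Fact (p : ℕ).Prime := ⟨p.2⟩
    exact tendsto_localDensity hk0 (by omega) ha
  obtain ⟨Q, hQ, c, hc, hlower⟩ := exists_le_singularProduct (k := k) (s := s) hk0 hs (by omega)
  -- the exponent `M` for which `D ^ M = c A ^ η` makes one shared part at least `D`
  set M : ℕ := (s - 1) * s * 3 * (s - 1)
  have hM : 0 < M := by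
    have : 0 < s - 1 := by omega
    have : 0 < s := by omega
    positivity
  have hM' : (0 : ℝ) < M := by exact_mod_cast hM
  set γ : ℝ := η / (4 * M)
  have hγ : 0 < γ := by positivity
  obtain ⟨K, hK0, hK⟩ := exists_four_pow_card_primeFactors_le hγ
  refine ⟨γ, hγ, (s * s : ℕ) * (2 ^ s * ((√(c ^ (1 / (M : ℝ))))⁻¹ * (K * (Q : ℝ) ^ γ))),
    fun A hA => ?_⟩
  have hA0 : 0 < A := by linarith
  set D : ℝ := (c * A ^ η) ^ (1 / (M : ℝ))
  have hD : 0 < D := by positivity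
  have hDM : D ^ M = c * A ^ η := by
    rw [← Real.rpow_natCast, ← Real.rpow_mul (by positivity), one_div, inv_mul_cancel₀ hM'.ne',
      Real.rpow_one]
  set N := ⌊A⌋₊
  have hNA : (N : ℝ) ≤ A := Nat.floor_le hA0.le
  set Y := (Finset.univ : Finset (Fin s)).offDiag.biUnion fun ij =>
    largeSharedPart s N Q D ij.1 ij.2
  have hsub : {a : Fin s → ℤ | (∀ j, a j ≠ 0) ∧ (∀ j, |(a j : ℝ)| ≤ A) ∧
        0 < singularProduct k a ∧ singularProduct k a < A ^ (-η)} ⊆ (Y : Set (Fin s → ℤ)) := by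
    rintro a ⟨ha, haA, hpos, hlt⟩
    have h1 := (hlower a ha hpos).trans_lt hlt
    have h2 : D ^ ((s - 1) * s) < pairProduct Q a := by
      have hP : (0 : ℝ) < pairProduct Q a := by
        have : 0 < pairProduct Q a :=
          Finset.prod_pos fun i _ => Finset.prod_pos fun j _ => one_le_sharedPart _ _
        exact_mod_cast this
      rw [Real.rpow_neg hA0.le, ← div_eq_mul_inv, div_lt_iff₀ (by positivity), inv_mul_eq_div,
        lt_div_iff₀ (by positivity), ← hDM, pow_mul, pow_mul] at h1
      exact lt_of_pow_lt_pow_left₀ 3 hP.le (lt_of_pow_lt_pow_left₀ (s - 1) (by positivity) h1)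
    obtain ⟨i, j, hij, hD⟩ := exists_le_sharedPart h2
    refine Finset.mem_coe.2 (Finset.mem_biUnion.2 ⟨(i, j), by simpa using hij,
      Finset.mem_filter.2 ⟨Fintype.mem_piFinset.2 fun l => mem_nonzeroInterval.2 ⟨ha l, ?_⟩, hD⟩⟩)
    refine Nat.le_floor ?_
    rw [Nat.cast_natAbs, Int.cast_abs]
    exact haA l
  have hYcard : (Y.card : ℝ) ≤ (s * s : ℕ) * ((2 * N) ^ s * ((√D)⁻¹ *
      (K * ((Q * N : ℕ) : ℝ) ^ γ))) := by
    calc (Y.card : ℝ) ≤ ∑ ij ∈ (Finset.univ : Finset (Fin s)).offDiag,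
          ((largeSharedPart s N Q D ij.1 ij.2).card : ℝ) := by
          exact_mod_cast Finset.card_biUnion_le
      _ ≤ ∑ ij ∈ (Finset.univ : Finset (Fin s)).offDiag, ((2 * N) ^ s * ((√D)⁻¹ *
          (K * ((Q * N : ℕ) : ℝ) ^ γ))) := Finset.sum_le_sum fun ij hij =>
          card_largeSharedPart_le hγ hK hQ N hD (Finset.mem_offDiag.1 hij).2.2
      _ ≤ _ := by
        rw [Finset.sum_const, nsmul_eq_mul]
        gcongr
        rw [Finset.offDiag_card, Finset.card_univ, Fintype.card_fin]
        omega
  have hsqrt : √D = √(c ^ (1 / (M : ℝ))) * A ^ (2 * γ) := by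
    have h1 : D = c ^ (1 / (M : ℝ)) * (A ^ (2 * γ)) ^ 2 := by
      simp only [D]
      rw [Real.mul_rpow hc.le (by positivity), ← Real.rpow_mul hA0.le, ← Real.rpow_natCast,
        ← Real.rpow_mul hA0.le]
      congr 2
      simp only [γ]
      push_cast
      field_simp
      ring
    rw [h1, Real.sqrt_mul (by positivity), Real.sqrt_sq (by positivity)]
  calc (Set.ncard _ : ℝ) ≤ (Y.card : ℝ) := by
        have := Set.ncard_le_ncard hsub Y.finite_toSet
        rw [Set.ncard_coe_finset] at this
        exact_mod_cast this
    _ ≤ _ := hYcard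
    _ ≤ (s * s : ℕ) * ((2 * A) ^ s * ((√D)⁻¹ * (K * (Q * A) ^ γ))) := by
      push_cast
      gcongr
    _ = (s * s : ℕ) * (2 ^ s * ((√(c ^ (1 / (M : ℝ))))⁻¹ * (K * (Q : ℝ) ^ γ))) *
        (A ^ s * (A ^ γ / A ^ (2 * γ))) := by
      rw [hsqrt, mul_pow, Real.mul_rpow (by positivity) hA0.le, mul_inv]
      ring
    _ = _ := by
      rw [← Real.rpow_sub hA0, ← Real.rpow_natCast A s, ← Real.rpow_add hA0]
      congr 2
      ring
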